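/- Let $\Sigma$ be a finite alphabet and $\Xi$ an infinite set of variables, disjoint from $\Sigma$. **Regex.** The set $\mathsf{RX}$ of regex consists of $\emptyset$ and of the expressions formed from $\varepsilon$, letters $a\in\Sigma$ and variable references $\&x$ ($x\in\Xi$) by concatenation $\alpha\cdot\beta$, disjunction $\alpha\vee\beta$, Kleene plus $\alpha^+$ and variable binding $\langle x:\alpha\rangle$, the latter only if $x$ does not occur in $\alpha$. The ref-language $\mathcal R(\alpha)$, a set of words over $\Sigma\cup\Xi\cup\{[_x,\,]_x : x\in\Xi\}$, is given by $\mathcal R(a)=\{a\}$ for $a\in\Sigma\cup\{\varepsilon\}$, $\mathcal R(\&x)=\{x\}$, $\mathcal R(\langle x:\alpha\rangle)=[_x\,\mathcal R(\alpha)\,]_x$, $\mathcal R(\alpha\beta)=\mathcal R(\alpha)\mathcal R(\beta)$, $\mathcal R(\alpha\vee\beta)=\mathcal R(\alpha)\cup\mathcal R(\beta)$, $\mathcal R(\alpha^+)=\mathcal R(\alpha)^+$. The dereference $\mathcal D(r)$ of a ref-word $r$ is obtained, from left to right, by replacing each occurrence of a variable $x$ by the dereferenced content $v$ of the closest factor $[_x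 v ]_x$ to its left (by $\varepsilon$ if there is none) and erasing all brackets. Then $\mathcal L(\alpha)=\{\mathcal D(r) : r\in\mathcal R(\alpha)\}$, and $\mathcal L(\emptyset)=\emptyset$. **Memory automata with trap state.** For $k\in\mathbb N$, a $\mathsf{TMFA}(k)$ is a tuple $M=(Q,\Sigma,\delta,q_0,F)$ with a finite set of states $Q$ containing a trap state $[\mathrm{trap}]$, $q_0\in Q$, $F\subseteq Q$, and $\delta: Q\times(\Sigma\cup\{\varepsilon\}\cup\{1,\dots,k\})\to\mathcal P(Q\times\{\mathsf o,\mathsf c,\mathsf r,\diamond\}^k)$ such that $\delta([\mathrm{trap}],b)=\{([\mathrm{trap}],\diamond,\dots,\diamond)\}$ for $b\in\Sigma\cup\{\varepsilon\}$ and $\delta([\mathrm{trap}],i)=\emptyset$ for $1\le i\le k$. A configuration consists of a state, the remaining input, and for each memory $i$ a content $u_i\in\Sigma^*$ and a status (open or closed). There is a step from $(q,vw,(u_i,r_i)_i)$ to $(p,w,(u_i',r_i')_i)$ if some $(p,s_1,\dots,s_k)\in\delta(q,b)$ satisfies either $b\in\Sigma\cup\{\varepsilon\}$ and $v=b$, or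 $b\in\{1,\dots,k\}$, $s_b=\mathsf c$ and $v=u_b$, where for every $i$: if $s_i=\diamond$, then the status is kept and $u_i'$ is $u_iv$ if memory $i$ is open and $u_i$ if it is closed; if $s_i=\mathsf o$, memory $i$ becomes open with content $v$; if $s_i=\mathsf c$, it becomes closed with content $u_i$; if $s_i=\mathsf r$, it becomes closed with content $\varepsilon$. In addition (memory recall failure), there is a step from $(q,vw,(u_i,r_i)_i)$ to $([\mathrm{trap}],w,(u_i,r_i)_i)$ if some $(p,s_1,\dots,s_k)\in\delta(q,b)$ with $b\in\{1,\dots,k\}$ and $s_b=\mathsf c$ satisfies $u_b=vv'$ with $v'\ne\varepsilon$, where $w=\varepsilon$ or the first letters of $v'$ and $w$ differ. The language $\mathcal L(M)$ is the set of all $w\in\Sigma^*$ such that a configuration with empty remaining input and state in $F$ can be reached in finitely many steps from state $q_0$ with remaining input $w$ and all memories closed and empty. Let $\mathsf{TMFA}$ be the class of all $\mathsf{TMFA}(k)$, $k\in\mathbb N$, and $\mathsf{TMFA}^{\mathrm{rej}}$ the subclass of those with $[\mathrm{trap}]\notin F$. **Theorem.** The following three classes of languages over $\Sigma$ coincide: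 $$\{\mathcal L(M) : M\in\mathsf{TMFA}\}=\{\mathcal L(M) : M\in\mathsf{TMFA}^{\mathrm{rej}}\}=\{\mathcal L(\alpha) : \alpha\in\mathsf{RX}\}.$$ -/

import Mathlib

universe u v

/-! ### Regex: regular expressions with back-references -/

/-- Letters of ref-words over the terminal alphabet `α` and the variable alphabet `Ξ`:
terminals, variables (references), and the opening and closing brackets of each variable. -/
inductive RefLetter (α : Type u) (Ξ : Type v) : Type (max u v)
  | terminal (a : α)
  | ref (x : Ξ)
  | opening (x : Ξ)
  | closing (x : Ξ)

/-- Expressions built by the formation rules of regex, without `∅` and before the side condition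
on variable bindings is imposed. -/
inductive RegexExpr (α : Type u) (Ξ : Type v) : Type (max u v)
  | eps
  | terminal (a : α)
  | ref (x : Ξ)
  | concat (e f : RegexExpr α Ξ)
  | alt (e f : RegexExpr α Ξ)
  | plus (e : RegexExpr α Ξ)
  | bind (x : Ξ) (e : RegexExpr α Ξ)

namespace RegexExpr

variable {α : Type u} {Ξ : Type v}

/-- The set of variables that occur (bound or referenced) in an expression. -/
def vars : RegexExpr α Ξ → Set Ξ
  | eps => ∅
  | terminal _ => ∅
  | ref x => {x}
  | concat e f => e.vars ∪ f.vars
  | alt e f => e.vars ∪ f.vars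
  | plus e => e.vars
  | bind x e => e.vars ∪ {x}

/-- The side condition of the syntax: in a binding of `x` to `e`, the variable `x` does not
occur in `e`. -/
def WellFormed : RegexExpr α Ξ → Prop
  | eps => True
  | terminal _ => True
  | ref _ => True
  | concat e f => e.WellFormed ∧ f.WellFormed
  | alt e f => e.WellFormed ∧ f.WellFormed
  | plus e => e.WellFormed
  | bind x e => x ∉ e.vars ∧ e.WellFormed

/-- The ref-language of an expression. -/
def refLanguage : RegexExpr α Ξ → Language (RefLetter α Ξ)
  | eps => {[]}
  | terminal a => {[RefLetter.terminal a]}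
  | ref x => {[RefLetter.ref x]}
  | concat e f => e.refLanguage * f.refLanguage
  | alt e f => e.refLanguage + f.refLanguage
  | plus e => e.refLanguage * KStar.kstar e.refLanguage
  | bind x e => {r | ∃ s ∈ e.refLanguage,
      r = RefLetter.opening x :: (s ++ [RefLetter.closing x])}

end RegexExpr

/-- Regex over the terminal alphabet `α` and the variable alphabet `Ξ`: either `∅`, or an
expression (in which `∅` does not occur) that satisfies the side condition on bindings. -/
inductive Regex (α : Type u) (Ξ : Type v) : Type (max u v)
  | empty
  | expr (e : RegexExpr α Ξ) (he : e.WellFormed)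

/-- The state of the left-to-right evaluation of a ref-word: the dereference `out` of the part
read so far, for each variable `x` the position `mark x` in `out` of the last opening bracket
of `x`, and the word `val x` that a reference to `x` currently stands for. -/
structure DerefState (α : Type u) (Ξ : Type v) : Type (max u v) where
  out : List α
  mark : Ξ → ℕ
  val : Ξ → List α

open Classical in
/-- Reading one letter of a ref-word. A closing bracket of `x` makes `x` stand for the
(dereferenced) factor between it and the last opening bracket of `x`. -/
noncomputable def DerefState.step {α : Type u} {Ξ : Type v} (s : DerefState α Ξ) :
    RefLetter α Ξ → DerefState α Ξ
  | RefLetter.terminal a => { s with out := s.out ++ [a] }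
  | RefLetter.ref x => { s with out := s.out ++ s.val x }
  | RefLetter.opening x => { s with mark := Function.update s.mark x s.out.length }
  | RefLetter.closing x => { s with val := Function.update s.val x (s.out.drop (s.mark x)) }

/-- The dereference of a ref-word: every reference to `x` stands for the dereferenced content of
the closest bracketed factor of `x` to its left (for the empty word if there is none), and
brackets are erased. -/
noncomputable def deref {α : Type u} {Ξ : Type v} (r : List (RefLetter α Ξ)) : List α :=
  (r.foldl DerefState.step ⟨[], fun _ => 0, fun _ => []⟩).out

namespace Regex

variable {α : Type u} {Ξ : Type v}

/-- The language of a regex: all dereferences of words of its ref-language. -/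
def language : Regex α Ξ → Language α
  | empty => 0
  | expr e _ => {w | ∃ r ∈ e.refLanguage, deref r = w}

end Regex

/-- The class of regex languages over the alphabet `α`, with variables from `Ξ`. -/
def regexLanguages (α : Type u) (Ξ : Type v) : Set (Language α) :=
  {L | ∃ e : Regex α Ξ, e.language = L}

/-! ### Memory automata with trap state -/

/-- Transition labels of an automaton with `k` memories: an input letter, the empty word, or the
recall of a memory. -/
inductive MemLabel (α : Type u) (k : ℕ) : Type u
  | letter (a : α)
  | eps
  | memory (i : Fin k)

/-- Memory instructions. -/
inductive MemInstr : Type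
  | opening
  | closing
  | reset
  | unchanged

/-- A memory configuration: the stored word, and whether the memory is open. -/
structure MemConfig (α : Type u) : Type u where
  content : List α
  isOpen : Bool

/-- The effect on a memory of an instruction executed while the word `v` is consumed. -/
def MemInstr.apply {α : Type u} (v : List α) : MemInstr → MemConfig α → MemConfig α
  | MemInstr.unchanged, ⟨u, true⟩ => ⟨u ++ v, true⟩
  | MemInstr.unchanged, ⟨u, false⟩ => ⟨u, false⟩
  | MemInstr.opening, _ => ⟨v, true⟩
  | MemInstr.closing, ⟨u, _⟩ => ⟨u, false⟩
  | MemInstr.reset, _ => ⟨[], false⟩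

/-- A memory automaton with trap state, with `k` memories, over the alphabet `α`. -/
structure TMFA (α : Type u) (k : ℕ) : Type (max u 1) where
  State : Type
  finite_state : Finite State
  trap : State
  start : State
  final : Set State
  trans : State → MemLabel α k → Set (State × (Fin k → MemInstr))
  trans_trap_letter : ∀ a, trans trap (MemLabel.letter a) = {(trap, fun _ => MemInstr.unchanged)}
  trans_trap_eps : trans trap MemLabel.eps = {(trap, fun _ => MemInstr.unchanged)}
  trans_trap_recall : ∀ i, trans trap (MemLabel.memory i) = ∅

namespace TMFA

variable {α : Type u} {k : ℕ}

/-- A configuration: the current state, the remaining input, and the memories. -/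
structure Config (M : TMFA α k) : Type u where
  state : M.State
  input : List α
  mem : Fin k → MemConfig α

/-- The one-step relation between configurations. In `recall_failure`, comparing `head?` covers
both a mismatch of letters and the case that the input ends before the memory content does. -/
inductive Step (M : TMFA α k) : M.Config → M.Config → Prop
  | letter {q p : M.State} {s : Fin k → MemInstr} {a : α} {w : List α}
      {m : Fin k → MemConfig α} (h : (p, s) ∈ M.trans q (MemLabel.letter a)) :
      Step M ⟨q, a :: w, m⟩ ⟨p, w, fun i => (s i).apply [a] (m i)⟩
  | eps {q p : M.State} {s : Fin k → MemInstr} {w : List α}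
      {m : Fin k → MemConfig α} (h : (p, s) ∈ M.trans q MemLabel.eps) :
      Step M ⟨q, w, m⟩ ⟨p, w, fun i => (s i).apply [] (m i)⟩
  | memory_recall {q p : M.State} {s : Fin k → MemInstr} {b : Fin k} {x w : List α}
      {m : Fin k → MemConfig α} (h : (p, s) ∈ M.trans q (MemLabel.memory b))
      (hb : s b = MemInstr.closing) (hx : x = (m b).content ++ w) :
      Step M ⟨q, x, m⟩ ⟨p, w, fun i => (s i).apply (m b).content (m i)⟩
  | recall_failure {q p : M.State} {s : Fin k → MemInstr} {b : Fin k} {x v v' w : List α}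
      {m : Fin k → MemConfig α} (h : (p, s) ∈ M.trans q (MemLabel.memory b))
      (hb : s b = MemInstr.closing) (hx : x = v ++ w) (hu : (m b).content = v ++ v')
      (hv' : v' ≠ []) (hw : v'.head? ≠ w.head?) :
      Step M ⟨q, x, m⟩ ⟨M.trap, w, m⟩

/-- The initial configuration on input `w`: all memories are empty and closed. -/
def initial (M : TMFA α k) (w : List α) : M.Config :=
  ⟨M.start, w, fun _ => ⟨[], false⟩⟩

/-- The language accepted by `M`. -/
def language (M : TMFA α k) : Language α :=
  {w | ∃ c : M.Config, Relation.ReflTransGen M.Step (M.initial w) c ∧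
    c.input = [] ∧ c.state ∈ M.final}

end TMFA

/-- The class of languages over `α` accepted by memory automata with trap state. -/
def tmfaLanguages (α : Type u) : Set (Language α) :=
  {L | ∃ (k : ℕ) (M : TMFA α k), M.language = L}

/-- The class of languages over `α` accepted by memory automata with rejecting trap state. -/
def tmfaRejLanguages (α : Type u) : Set (Language α) :=
  {L | ∃ (k : ℕ) (M : TMFA α k), M.trap ∉ M.final ∧ M.language = L}

/-! The inclusions form a cycle: regex languages are accepted with rejecting trap, rejecting traps
are a special case, and every automaton language is a regex language. The link is a regular set of
ref-words with a strict evaluation `Eval` by memories, which recalls and opens only closed memories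
and closes only open ones. Where it is defined it agrees with dereferencing (`Eval.deref_eq`).

From regex to automata, a ref-language is regular, and a finite automaton for it becomes a memory
automaton: brackets turn into ε-moves, references into recalls, and failures end in a non-final
trap.

From automata to regex there are two obstacles. The first is acceptance by the trap. A failed recall
reads a prefix of the memory content and then anything that does not begin with the next letter a of
the content, so that prefix must be available by itself. The letter a is guessed once for the whole
run, and the memories that contain the critical occurrence of a are kept in two parts around it.
That occurrence was either read from the input or copied from a recalled memory that was already
split there (`Reads.simulates_split`). Failure thus becomes a regular condition on ref-words
(`isMemoryRegular_language`).

The second obstacle is that brackets of different memories may overlap, whereas those of a regex are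
nested. The open variables are kept on a stack ordered by closing time, the earliest on top
(`exists_run`). To open x, the variables above its place are popped, x is pushed, and they are
pushed back. Each pop ends a piece of a variable. While open, a variable only moves upwards, so its
pieces, named by their heights, come in the right order and are boundedly many; a reference becomes
the concatenation of references to all pieces (`Run.eval`). Stacks have bounded height, so Kleene's
theorem at each height turns the nested ref-words into a regex (`isRefLanguage_nested`). -/

/-! ### Regular languages and paths in graphs labelled by languages -/

namespace Language

variable {L : Type*}

/-- Closure of a class of languages under the regular operations. -/
structure RationallyClosed (C : Language L → Prop) : Prop where
  zero : C 0
  one : C 1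
  add {l m} : C l → C m → C (l + m)
  mul {l m} : C l → C m → C (l * m)
  kstar {l} : C l → C (KStar.kstar l)

theorem RationallyClosed.iSup {C : Language L → Prop} (hC : RationallyClosed C) {ι : Type*}
    [Finite ι] {f : ι → Language L} (hf : ∀ i, C (f i)) : C (⨆ i, f i) := by
  have key : ∀ s : Set ι, s.Finite → C (⨆ i ∈ s, f i) := by
    intro s hs
    induction s, hs using Set.Finite.induction_on with
    | empty => rw [iSup_emptyset]; exact hC.zero
    | @insert a s _ _ ih => rw [iSup_insert]; exact hC.add (hf a) ih
  simpa using key Set.univ Set.finite_univ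

theorem RationallyClosed.exists {C : Language L → Prop} (hC : RationallyClosed C) {ι : Type*}
    [Finite ι] {f : ι → Language L} (hf : ∀ i, C (f i)) : C {w | ∃ i, w ∈ f i} := by
  have : (⨆ i, f i) = {w | ∃ i, w ∈ f i} := Language.ext fun w => mem_iSup
  exact this ▸ hC.iSup hf

theorem RationallyClosed.and {C : Language L → Prop} (hC : RationallyClosed C) {p : Prop}
    {l : Language L} (hl : C l) : C {w | p ∧ w ∈ l} := by
  by_cases hp : p
  · have : l = {w | p ∧ w ∈ l} := Language.ext fun w => ⟨fun h => ⟨hp, h⟩, And.right⟩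
    exact this ▸ hl
  · have : (0 : Language L) = {w | p ∧ w ∈ l} :=
      Language.ext fun w => ⟨fun h => absurd h (notMem_zero w), fun h => absurd h.1 hp⟩
    exact this ▸ hC.zero

/-- A language is regular once it has finitely many left quotients. For a product, x⁻¹(lm) is
(x⁻¹l)m together with all v⁻¹m for x = uv with u in l, so it is determined by one quotient of l and
a set of quotients of m; the star is similar. -/
theorem rationallyClosed_isRegular : RationallyClosed (IsRegular (T := L)) where
  zero := by
    refine IsRegular.of_finite_range_leftQuotient ((Set.finite_singleton 0).subset ?_)
    rintro _ ⟨x, rfl⟩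
    rfl
  one := by
    refine IsRegular.of_finite_range_leftQuotient ((Set.toFinite {0, 1}).subset ?_)
    rintro _ ⟨x, rfl⟩
    rcases x with _ | ⟨a, x⟩
    · right; rfl
    · left
      ext y
      simp [mem_one, notMem_zero]
  add := IsRegular.add
  mul {l m} hl hm := by
    refine IsRegular.of_finite_range_leftQuotient
      (((hl.finite_range_leftQuotient.prod hm.finite_range_leftQuotient.powerset).image
        fun A => A.1 * m + sSup A.2).subset ?_)
    rintro _ ⟨x, rfl⟩
    refine ⟨(l.leftQuotient x, m.leftQuotient '' {v | ∃ u ∈ l, x = u ++ v}),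
      ⟨⟨x, rfl⟩, Set.image_subset_range _ _⟩, ?_⟩
    ext w
    simp only [sSup_image, mem_add, mem_mul, mem_iSup, mem_leftQuotient]
    constructor
    · rintro (⟨a, ha, b, hb, rfl⟩ | ⟨v, ⟨u, hu, rfl⟩, hw⟩)
      · exact ⟨_, ha, b, hb, by simp⟩
      · exact ⟨u, hu, _, hw, by simp⟩
    · rintro ⟨a, ha, b, hb, h⟩
      rcases List.append_eq_append_iff.1 h with ⟨c, rfl, rfl⟩ | ⟨c, rfl, rfl⟩
      · exact Or.inr ⟨c, ⟨a, ha, rfl⟩, hb⟩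
      · exact Or.inl ⟨c, ha, b, hb, rfl⟩
  kstar {l} hl := by
    refine IsRegular.of_finite_range_leftQuotient
      (((hl.finite_range_leftQuotient.powerset.image fun A => sSup A * KStar.kstar l).insert
        (KStar.kstar l)).subset ?_)
    rintro _ ⟨x, rfl⟩
    -- For empty x the formula used below would give l·l*, which can miss the empty word.
    rcases eq_or_ne x [] with rfl | hx
    · exact Or.inl rfl
    refine Or.inr ⟨l.leftQuotient '' {v | ∃ u ∈ KStar.kstar l, x = u ++ v},
      Set.image_subset_range _ _, ?_⟩
    ext w
    simp only [sSup_image, mem_mul, mem_iSup, mem_leftQuotient]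
    constructor
    · rintro ⟨a, ⟨v, ⟨u, hu, rfl⟩, ha⟩, b, hb, rfl⟩
      obtain ⟨U, rfl, hU⟩ := mem_kstar.1 hu
      obtain ⟨B, rfl, hB⟩ := mem_kstar.1 hb
      refine mem_kstar.2 ⟨U ++ (v ++ a) :: B, by simp, ?_⟩
      simp only [List.mem_append, List.mem_cons]
      rintro y (h | rfl | h)
      exacts [hU y h, ha, hB y h]
    · intro h
      obtain ⟨F, hF, hl'⟩ := mem_kstar.1 h
      clear h
      induction F generalizing x with
      | nil => simp_all
      | cons f F ih =>
        rw [List.flatten_cons] at hF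
        have hFl : F.flatten ∈ KStar.kstar l := join_mem_kstar fun y hy => hl' y (by simp [hy])
        rcases List.append_eq_append_iff.1 hF with ⟨c, rfl, rfl⟩ | ⟨c, rfl, hc⟩
        · exact ⟨c, ⟨x, ⟨[], nil_mem_kstar l, rfl⟩, hl' _ (by simp)⟩, _, hFl, rfl⟩
        -- If the factor f ends exactly where x ends, v = f serves, with the empty word in its
        -- quotient; otherwise the rest c of x is treated by induction.
        · rcases eq_or_ne c [] with rfl | hc'
          · refine ⟨[], ⟨f, ⟨[], nil_mem_kstar l, by simp⟩, by simpa using hl' f (by simp)⟩,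
              F.flatten, hFl, by simpa using hc⟩
          · obtain ⟨a, ⟨v, ⟨u, hu, rfl⟩, ha⟩, b, hb, rfl⟩ :=
              ih c hc' hc.symm fun y hy => hl' y (by simp [hy])
            obtain ⟨U, rfl, hU⟩ := mem_kstar.1 hu
            refine ⟨a, ⟨v, ⟨f ++ U.flatten, mem_kstar.2 ⟨f :: U, by simp, ?_⟩, by simp⟩, ha⟩,
              b, hb, rfl⟩
            rintro y (_ | ⟨_, h⟩)
            exacts [hl' f (by simp), hU y h]

theorem isRegular_letter (a : L) : IsRegular ({[a]} : Language L) := by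
  refine IsRegular.of_finite_range_leftQuotient ((Set.toFinite {0, 1, {[a]}}).subset ?_)
  rintro _ ⟨x, rfl⟩
  rcases x with _ | ⟨b, _ | ⟨c, x⟩⟩
  · right; right; rfl
  · by_cases hb : b = a
    · right; left
      ext y
      change [b] ++ y = [a] ↔ y = []
      simp [hb]
    · left
      ext y
      change [b] ++ y = [a] ↔ False
      simp [hb]
  · left
    ext y
    change (b :: c :: x) ++ y = [a] ↔ False
    simp

theorem isRegular_word (u : List L) : IsRegular ({u} : Language L) := by
  induction u with
  | nil => exact rationallyClosed_isRegular.one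
  | cons a u ih =>
    convert rationallyClosed_isRegular.mul (isRegular_letter a) ih using 1
    ext w
    change w = a :: u ↔ _
    rw [mem_mul]
    constructor
    · rintro rfl
      exact ⟨[a], rfl, u, rfl, rfl⟩
    · rintro ⟨_, rfl, _, rfl, rfl⟩
      rfl

/-! ### Kleene's theorem for graphs whose edges carry languages -/

/-- The words along a path in a graph whose edges carry languages. -/
inductive Path {σ : Type*} (E : σ → σ → Language L) : σ → List L → σ → Prop
  | nil (q : σ) : Path E q [] q
  | cons {p q r : σ} {u w : List L} (h : u ∈ E p q) (hw : Path E q w r) : Path E p (u ++ w) r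

theorem Path.append {σ : Type*} {E : σ → σ → Language L} {p q r : σ} {u w : List L}
    (h : Path E p u q) (h' : Path E q w r) : Path E p (u ++ w) r := by
  induction h with
  | nil => exact h'
  | cons h _ ih => rw [List.append_assoc]; exact .cons h (ih h')

theorem Path.single {σ : Type*} {E : σ → σ → Language L} {p q : σ} {u : List L}
    (h : u ∈ E p q) : Path E p u q := by
  simpa using Path.cons h (.nil q)

open Classical in
/-- Words along paths all of whose inner vertices are in the given list. -/
noncomputable def pathsThrough {σ : Type*} (E : σ → σ → Language L) :
    List σ → σ → σ → Language L
  | [], p, q => E p q + if p = q then 1 else 0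
  | s :: l, p, q => pathsThrough E l p q +
      pathsThrough E l p s * KStar.kstar (pathsThrough E l s s) * pathsThrough E l s q

section

variable {σ : Type*} {E : σ → σ → Language L}

/-- At the newly admitted vertex both factors end in a star of loops there, and two stars merge into
one. At an older vertex the product is distributed and joined by induction; a detour from `a`
through `s` back to `a` is one more loop at `a`. -/
theorem pathsThrough_mul_le {l : List σ} {s : σ} (hs : s ∈ l) (p q : σ) :
    pathsThrough E l p s * pathsThrough E l s q ≤ pathsThrough E l p q := by
  induction l generalizing s p q with
  | nil => simp at hs
  | cons a l ih =>
    simp only [pathsThrough]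
    set A := pathsThrough E l
    set X := KStar.kstar (A a a) with hX
    have h1 : (1 : Language L) ≤ X := one_le_kstar
    have hXX : X * X ≤ X := kstar_mul_kstar (A a a) |>.le
    rcases List.mem_cons.1 hs with rfl | hs
    · have hl : A p s + A p s * X * A s s ≤ A p s * X := by
        refine add_le ?_ ?_
        · simpa using mul_le_mul_right h1 (A p s)
        · rw [mul_assoc]
          exact mul_le_mul_right kstar_mul_le_kstar _
      have hr : A s q + A s s * X * A s q ≤ X * A s q := by
        refine add_le ?_ ?_
        · simpa using mul_le_mul_left h1 (A s q)
        · exact mul_le_mul_left mul_kstar_le_kstar _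
      calc _ ≤ (A p s * X) * (X * A s q) := mul_le_mul' hl hr
        _ = A p s * (X * X) * A s q := by simp only [mul_assoc]
        _ ≤ A p s * X * A s q := mul_le_mul_left (mul_le_mul_right hXX _) _
        _ ≤ _ := le_add_of_nonneg_left bot_le
    · have ih' := fun p q => ih hs p q
      rw [add_mul, mul_add, mul_add]
      refine add_le (add_le ?_ ?_) (add_le ?_ ?_)
      · exact (ih' p q).trans (le_add_of_nonneg_right bot_le)
      · refine le_trans ?_ (le_add_of_nonneg_left bot_le)
        rw [← mul_assoc, ← mul_assoc]
        exact mul_le_mul_left (mul_le_mul_left (ih' p a) _) _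
      · refine le_trans ?_ (le_add_of_nonneg_left bot_le)
        rw [mul_assoc]
        exact mul_le_mul_right (ih' a q) _
      · refine le_trans ?_ (le_add_of_nonneg_left bot_le)
        calc _ = A p a * X * (A a s * A s a) * X * A a q := by simp only [mul_assoc]
          _ ≤ A p a * X * A a a * X * A a q :=
            mul_le_mul_left (mul_le_mul_left (mul_le_mul_right (ih' a a) _) _) _
          _ = A p a * (X * A a a * X) * A a q := by simp only [mul_assoc]
          _ ≤ A p a * X * A a q := by
            refine mul_le_mul_left (mul_le_mul_right ?_ _) _
            exact (mul_le_mul_left kstar_mul_le_kstar _).trans hXX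

theorem edge_le_pathsThrough (l : List σ) (p q : σ) : E p q ≤ pathsThrough E l p q := by
  induction l with
  | nil => exact le_add_of_nonneg_right bot_le
  | cons a l ih => exact ih.trans (le_add_of_nonneg_right bot_le)

theorem one_le_pathsThrough (l : List σ) (p : σ) : 1 ≤ pathsThrough E l p p := by
  induction l with
  | nil => simp [pathsThrough]
  | cons a l ih => exact ih.trans (le_add_of_nonneg_right bot_le)

theorem Path.mem_pathsThrough {l : List σ} (hl : ∀ s, s ∈ l) {p q : σ} {w : List L}
    (h : Path E p w q) : w ∈ pathsThrough E l p q := by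
  induction h with
  | nil q => exact one_le_pathsThrough l q rfl
  | @cons p q r u w h _ ih =>
    exact pathsThrough_mul_le (hl q) p r
      (append_mem_mul (edge_le_pathsThrough l p q h) ih)

theorem path_of_mem_pathsThrough {l : List σ} {p q : σ} {w : List L}
    (h : w ∈ pathsThrough E l p q) : Path E p w q := by
  induction l generalizing p q w with
  | nil =>
    rcases h with h | h
    · exact .single h
    · split_ifs at h with hpq
      · subst hpq
        rw [show w = [] from h]
        exact .nil p
      · exact absurd h (notMem_zero w)
  | cons s l ih =>
    rcases h with h | h
    · exact ih h
    · obtain ⟨_, h', w₃, h₃, rfl⟩ := mem_mul.1 h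
      obtain ⟨w₁, h₁, w₂, h₂, rfl⟩ := mem_mul.1 h'
      refine ((ih h₁).append ?_).append (ih h₃)
      obtain ⟨F, rfl, hF⟩ := mem_kstar.1 h₂
      clear h h' h₂
      induction F with
      | nil => exact .nil s
      | cons f F ihF =>
        rw [List.flatten_cons]
        exact (ih (hF f (by simp))).append (ihF fun y hy => hF y (by simp [hy]))

theorem RationallyClosed.pathsThrough {C : Language L → Prop} (hC : RationallyClosed C)
    (hE : ∀ p q, C (E p q)) (l : List σ) (p q : σ) : C (pathsThrough E l p q) := by
  induction l generalizing p q with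
  | nil =>
    refine hC.add (hE p q) ?_
    split_ifs
    exacts [hC.one, hC.zero]
  | cons s l ih => exact hC.add (ih p q) (hC.mul (hC.mul (ih p s) (hC.kstar (ih s s))) (ih s q))

/-- Kleene's theorem for finite graphs whose edges carry languages. -/
theorem RationallyClosed.path [Finite σ] {C : Language L → Prop} (hC : RationallyClosed C)
    (hE : ∀ p q, C (E p q)) (p q : σ) : C {w | Path E p w q} := by
  have := Fintype.ofFinite σ
  have : Language.pathsThrough E (Finset.univ : Finset σ).toList p q = {w | Path E p w q} :=
    Language.ext fun w => ⟨path_of_mem_pathsThrough, fun h => Path.mem_pathsThrough (by simp) h⟩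
  exact this ▸ hC.pathsThrough hE _ p q

end

end Language

/-! ### Evaluation of ref-words by memories -/

section

variable {α X : Type*}

@[simp]
theorem MemInstr.apply_unchanged_isOpen (v : List α) (m : MemConfig α) :
    (MemInstr.unchanged.apply v m).isOpen = m.isOpen := by
  rcases m with ⟨u, _ | _⟩ <;> rfl

theorem MemInstr.apply_unchanged_content (v : List α) (m : MemConfig α) :
    (MemInstr.unchanged.apply v m).content =
      if m.isOpen then m.content ++ v else m.content := by
  rcases m with ⟨u, _ | _⟩ <;> rfl

@[simp]
theorem MemInstr.apply_unchanged_nil (m : MemConfig α) : MemInstr.unchanged.apply [] m = m := by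
  rcases m with ⟨u, _ | _⟩ <;> simp [MemInstr.apply]

open Classical in
/-- `Eval m r w m'`: starting with memories `m`, the ref-word `r` denotes the word `w` and leads to
the memories `m'`. Only closed memories may be recalled or opened, and only open ones closed. -/
inductive Eval : (X → MemConfig α) → List (RefLetter α X) → List α → (X → MemConfig α) → Prop
  | nil (m) : Eval m [] [] m
  | terminal {m m' a r w} (h : Eval (fun y => MemInstr.unchanged.apply [a] (m y)) r w m') :
      Eval m (RefLetter.terminal a :: r) (a :: w) m'
  | ref {m m' x r w} (hx : (m x).isOpen = false)
      (h : Eval (fun y => MemInstr.unchanged.apply (m x).content (m y)) r w m') :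
      Eval m (RefLetter.ref x :: r) ((m x).content ++ w) m'
  | opening {m m' x r w} (hx : (m x).isOpen = false)
      (h : Eval (Function.update m x ⟨[], true⟩) r w m') :
      Eval m (RefLetter.opening x :: r) w m'
  | closing {m m' x r w} (hx : (m x).isOpen = true)
      (h : Eval (Function.update m x ⟨(m x).content, false⟩) r w m') :
      Eval m (RefLetter.closing x :: r) w m'

theorem Eval.append {m m' m'' : X → MemConfig α} {r r' w w'} (h : Eval m r w m')
    (h' : Eval m' r' w' m'') : Eval m (r ++ r') (w ++ w') m'' := by
  induction h with
  | nil => exact h'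
  | terminal _ ih => exact .terminal (ih h')
  | ref hx _ ih => rw [List.append_assoc]; exact .ref hx (ih h')
  | opening hx _ ih => exact .opening hx (ih h')
  | closing hx _ ih => exact .closing hx (ih h')

theorem Eval.unique {m m' m'' : X → MemConfig α} {r w w'} (h : Eval m r w m')
    (h' : Eval m r w' m'') : w = w' ∧ m' = m'' := by
  induction h generalizing w' m'' with
  | nil => cases h'; exact ⟨rfl, rfl⟩
  | terminal _ ih =>
    cases h' with | terminal h' => exact ⟨by rw [(ih h').1], (ih h').2⟩
  | ref hx _ ih =>
    cases h' with | ref _ h' => exact ⟨by rw [(ih h').1], (ih h').2⟩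
  | opening hx _ ih =>
    cases h' with | opening _ h' => exact ih h'
  | closing hx _ ih =>
    cases h' with | closing _ h' => exact ih h'

/-- The memories at the beginning: empty and closed. -/
def emptyMem : X → MemConfig α := fun _ => ⟨[], false⟩

/-- The content of an open memory is the output since its last opening bracket, that of a closed one
is the stored value. The bound on `mark` makes dropping commute with appending to the output. -/
theorem Eval.foldl_step {m m' : X → MemConfig α} {r w} (h : Eval m r w m') (s : DerefState α X)
    (hs : ∀ x, s.mark x ≤ s.out.length ∧
      (m x).content = if (m x).isOpen then s.out.drop (s.mark x) else s.val x) :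
    (r.foldl DerefState.step s).out = s.out ++ w := by
  induction h generalizing s with
  | nil => simp
  | terminal _ ih =>
    rw [List.foldl_cons, ih]
    · simp [DerefState.step]
    · intro x
      obtain ⟨h1, h2⟩ := hs x
      refine ⟨by simp [DerefState.step]; omega, ?_⟩
      rw [MemInstr.apply_unchanged_content, h2]
      simp only [MemInstr.apply_unchanged_isOpen, DerefState.step]
      split_ifs
      · rw [List.drop_append_of_le_length h1]
      · rfl
  | @ref m m' y r w hy _ ih =>
    have hval : s.val y = (m y).content := by simp [(hs y).2, hy]
    rw [List.foldl_cons, ih]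
    · simp [DerefState.step, hval]
    · intro x
      obtain ⟨h1, h2⟩ := hs x
      refine ⟨by simp [DerefState.step]; omega, ?_⟩
      rw [MemInstr.apply_unchanged_content, h2]
      simp only [MemInstr.apply_unchanged_isOpen, DerefState.step, hval]
      split_ifs
      · rw [List.drop_append_of_le_length h1]
      · rfl
  | @opening m m' y r w hy _ ih =>
    rw [List.foldl_cons, ih]
    · simp [DerefState.step]
    · intro x
      obtain ⟨h1, h2⟩ := hs x
      by_cases hxy : x = y
      · subst hxy
        simp [DerefState.step]
      · simpa [DerefState.step, hxy] using hs x
  | @closing m m' y r w hy _ ih =>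
    rw [List.foldl_cons, ih]
    · simp [DerefState.step]
    · intro x
      by_cases hxy : x = y
      · subst hxy
        have := hs x
        simp_all [DerefState.step]
      · simpa [DerefState.step, hxy] using hs x

theorem Eval.deref_eq {m' : X → MemConfig α} {r w} (h : Eval emptyMem r w m') : deref r = w := by
  have := h.foldl_step ⟨[], fun _ => 0, fun _ => []⟩ (by simp [emptyMem])
  simpa [deref] using this

/-- The variables of a letter of a ref-word. -/
def RefLetter.vars : RefLetter α X → Set X
  | terminal _ => ∅
  | ref x => {x}
  | opening x => {x}
  | closing x => {x}

end

/-! ### From regex to automata -/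

namespace RegexExpr

variable {α : Type u} {Ξ : Type v}

theorem finite_vars (e : RegexExpr α Ξ) : e.vars.Finite := by
  induction e with
  | eps => exact Set.finite_empty
  | terminal => exact Set.finite_empty
  | ref x => exact Set.finite_singleton x
  | concat _ _ h h' => exact h.union h'
  | alt _ _ h h' => exact h.union h'
  | plus _ h => exact h
  | bind x _ h => exact h.union (Set.finite_singleton x)

theorem isRegular_refLanguage (e : RegexExpr α Ξ) : e.refLanguage.IsRegular := by
  have hC := Language.rationallyClosed_isRegular (L := RefLetter α Ξ)
  induction e with
  | eps => exact hC.one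
  | terminal a => exact Language.isRegular_letter _
  | ref x => exact Language.isRegular_letter _
  | concat _ _ h h' => exact hC.mul h h'
  | alt _ _ h h' => exact hC.add h h'
  | plus _ h => exact hC.mul h (hC.kstar h)
  | bind x e h =>
    convert hC.mul (Language.isRegular_letter (RefLetter.opening x))
      (hC.mul h (Language.isRegular_letter (RefLetter.closing x))) using 1
    ext r
    simp only [Language.mem_mul]
    constructor
    · rintro ⟨s, hs, rfl⟩
      exact ⟨_, rfl, _, ⟨s, hs, _, rfl, rfl⟩, rfl⟩
    · rintro ⟨_, rfl, _, ⟨s, hs, _, rfl, rfl⟩, rfl⟩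
      exact ⟨s, hs, rfl⟩

theorem vars_subset_of_mem {e : RegexExpr α Ξ} {r} (hr : r ∈ e.refLanguage) :
    ∀ l ∈ r, l.vars ⊆ e.vars := by
  induction e generalizing r with
  | eps => rw [show r = [] from hr]; simp
  | terminal a => rw [show r = [_] from hr]; simp [RefLetter.vars]
  | ref x => rw [show r = [_] from hr]; simp [RefLetter.vars, vars]
  | concat e f he hf =>
    obtain ⟨s, hs, t, ht, rfl⟩ := Language.mem_mul.1 hr
    intro l hl
    rcases List.mem_append.1 hl with hl | hl
    · exact (he hs l hl).trans Set.subset_union_left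
    · exact (hf ht l hl).trans Set.subset_union_right
  | alt e f he hf =>
    rcases hr with hr | hr
    · exact fun l hl => (he hr l hl).trans Set.subset_union_left
    · exact fun l hl => (hf hr l hl).trans Set.subset_union_right
  | plus e he =>
    obtain ⟨s, hs, t, ht, rfl⟩ := Language.mem_mul.1 hr
    obtain ⟨F, rfl, hF⟩ := Language.mem_kstar.1 ht
    intro l hl
    rcases List.mem_append.1 hl with hl | hl
    · exact he hs l hl
    · obtain ⟨f, hf, hl⟩ := List.mem_flatten.1 hl
      exact he (hF f hf) l hl
  | bind x e he =>
    obtain ⟨s, hs, rfl⟩ := hr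
    intro l hl
    simp only [List.mem_cons, List.mem_append, List.not_mem_nil, or_false] at hl
    rcases hl with rfl | hl | rfl
    · exact Set.subset_union_right
    · exact (he hs l hl).trans Set.subset_union_left
    · exact Set.subset_union_right

/-- The side condition on bindings is what makes ref-words evaluable: inside a binding of `x` only
other variables are used. Each subexpression restores the status of all memories, so concatenations
and iterations can be chained. -/
theorem exists_eval {e : RegexExpr α Ξ} (he : e.WellFormed) {r} (hr : r ∈ e.refLanguage)
    (m : Ξ → MemConfig α) (hm : ∀ x ∈ e.vars, (m x).isOpen = false) :
    ∃ w m', Eval m r w m' ∧ ∀ x, (m' x).isOpen = (m x).isOpen := by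
  induction e generalizing r m with
  | eps => rw [show r = [] from hr]; exact ⟨_, _, .nil m, fun _ => rfl⟩
  | terminal a =>
    rw [show r = [_] from hr]
    exact ⟨_, _, .terminal (.nil _), by simp⟩
  | ref x =>
    rw [show r = [_] from hr]
    exact ⟨_, _, .ref (hm x rfl) (.nil _), by simp⟩
  | concat e f ihe ihf =>
    obtain ⟨s, hs, t, ht, rfl⟩ := Language.mem_mul.1 hr
    obtain ⟨w, m₁, h₁, h₁'⟩ := ihe he.1 hs m fun x hx => hm x (Or.inl hx)
    obtain ⟨w', m₂, h₂, h₂'⟩ := ihf he.2 ht m₁ fun x hx => (h₁' x).trans (hm x (Or.inr hx))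
    exact ⟨_, _, h₁.append h₂, fun x => (h₂' x).trans (h₁' x)⟩
  | alt e f ihe ihf =>
    rcases hr with hr | hr
    · exact ihe he.1 hr m fun x hx => hm x (Or.inl hx)
    · exact ihf he.2 hr m fun x hx => hm x (Or.inr hx)
  | plus e ihe =>
    obtain ⟨s, hs, t, ht, rfl⟩ := Language.mem_mul.1 hr
    obtain ⟨F, rfl, hF⟩ := Language.mem_kstar.1 ht
    rw [← List.flatten_cons]
    replace hF : ∀ f ∈ s :: F, f ∈ e.refLanguage := by
      rintro f (_ | ⟨_, h⟩)
      exacts [hs, hF f h]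
    generalize s :: F = G at hF
    clear hr ht hs
    induction G generalizing m with
    | nil => exact ⟨_, _, .nil m, fun _ => rfl⟩
    | cons g G ih =>
      obtain ⟨w, m₁, h₁, h₁'⟩ := ihe he (hF g (by simp)) m hm
      obtain ⟨w', m₂, h₂, h₂'⟩ := ih m₁ (fun x hx => (h₁' x).trans (hm x hx))
        fun f hf => hF f (by simp [hf])
      rw [List.flatten_cons]
      exact ⟨_, _, h₁.append h₂, fun x => (h₂' x).trans (h₁' x)⟩
  | bind x e ihe =>
    classical
    obtain ⟨s, hs, rfl⟩ := hr
    have hx : (m x).isOpen = false := hm x (Or.inr rfl)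
    obtain ⟨w, m₁, h₁, h₁'⟩ := ihe he.2 hs (Function.update m x ⟨[], true⟩) fun y hy => by
      have : y ≠ x := by rintro rfl; exact he.1 hy
      simpa [this] using hm y (Or.inl hy)
    have h₂ := h₁.append (.closing (x := x) (by simp [h₁']) (.nil _))
    refine ⟨_, _, .opening hx (by convert h₂), ?_⟩
    · intro y
      by_cases hy : y = x
      · subst hy
        simp [hx]
      · simp [hy, h₁']

end RegexExpr

/-- The memory instructions that act on a single memory only. -/
def instrAt {k : ℕ} (i : Fin k) (s : MemInstr) : Fin k → MemInstr :=
  Function.update (fun _ => MemInstr.unchanged) i s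

open Classical in
theorem instrAt_apply_nil {α X : Type*} {k : ℕ} {g : Fin k → X} (hg : g.Injective) (i : Fin k)
    (s : MemInstr) (m : X → MemConfig α) :
    (fun j => (instrAt i s j).apply [] ((m ∘ g) j)) =
      Function.update m (g i) (s.apply [] (m (g i))) ∘ g := by
  ext1 j
  by_cases hj : j = i
  · subst hj; simp [instrAt]
  · simp [instrAt, hj, hg.ne hj]

/-- A recall has to carry the instruction `closing` for the recalled memory; on a memory that is
closed already, this changes nothing. -/
theorem instrAt_apply_closed {α X : Type*} {k : ℕ} {g : Fin k → X} (i : Fin k) (v : List α)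
    (m : X → MemConfig α) (hi : (m (g i)).isOpen = false) :
    (fun j => (instrAt i .closing j).apply v ((m ∘ g) j)) =
      (fun y => MemInstr.unchanged.apply v (m y)) ∘ g := by
  ext1 j
  by_cases hj : j = i
  · subst hj
    simp only [Function.comp, instrAt, Function.update_self]
    rcases hmj : m (g j) with ⟨u, _ | _⟩
    · rfl
    · simp [hmj] at hi
  · simp [instrAt, hj]

/-- The memory automaton that reads a ref-word accepted by a finite automaton `D`, with one
memory for each variable in the range of `g`. -/
def DFA.toTMFA {α : Type u} {Ξ : Type v} {σ : Type} [Finite σ] {k : ℕ}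
    (D : DFA (RefLetter α Ξ) σ) (g : Fin k → Ξ) : TMFA α k where
  State := Option σ
  finite_state := inferInstance
  trap := none
  start := some D.start
  final := some '' D.accept
  trans
    | none, .letter _ => {(none, fun _ => .unchanged)}
    | none, .eps => {(none, fun _ => .unchanged)}
    | none, .memory _ => ∅
    | some q, .letter a => {(some (D.step q (.terminal a)), fun _ => .unchanged)}
    | some q, .eps => {x | ∃ i, x = (some (D.step q (.opening (g i))), instrAt i .opening) ∨
        x = (some (D.step q (.closing (g i))), instrAt i .closing)}
    | some q, .memory i => {(some (D.step q (.ref (g i))), instrAt i .closing)}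
  trans_trap_letter _ := rfl
  trans_trap_eps := rfl
  trans_trap_recall _ := rfl

namespace DFA

variable {α : Type u} {Ξ : Type v} {σ : Type} [Finite σ] {k : ℕ}
  {D : DFA (RefLetter α Ξ) σ} {g : Fin k → Ξ}

theorem toTMFA_trap {c c' : (D.toTMFA g).Config}
    (h : Relation.ReflTransGen (D.toTMFA g).Step c c') (hc : c.state = (none : Option σ)) :
    c'.state = (none : Option σ) := by
  induction h with
  | refl => exact hc
  | tail _ h ih =>
    cases h with
    | letter h => cases ih; cases h; rfl
    | eps h => cases ih; cases h; rfl
    | memory_recall h => cases ih; cases h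
    | recall_failure h => rfl

/-- The automaton does not check that brackets are used properly. Hence the conclusion is
conditional on the evaluability of `r`, which is known only when the complete word is seen to lie in
the ref-language. -/
theorem exists_of_toTMFA (hg : g.Injective) {c c' : (D.toTMFA g).Config}
    (h : Relation.ReflTransGen (D.toTMFA g).Step c c')
    (hi : c'.input = []) (hf : c'.state ∈ (D.toTMFA g).final) (q : σ) (hq : c.state = some q) :
    ∃ r, D.evalFrom q r ∈ D.accept ∧ ∀ m w m', m ∘ g = c.mem → Eval m r w m' → w = c.input := by
  classical
  induction h using Relation.ReflTransGen.head_induction_on generalizing q with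
  | refl =>
    refine ⟨[], ?_, ?_⟩
    · obtain ⟨q', hq', h⟩ := hf
      rw [hq, Option.some_inj] at h
      simpa [← h] using hq'
    · intro m w m' _ h
      cases h
      exact hi.symm
  | head hs hr ih =>
    cases hs with
    | letter h =>
      cases hq
      cases h
      obtain ⟨r, h₁, h₂⟩ := ih _ rfl
      refine ⟨_ :: r, h₁, ?_⟩
      intro m w m' hm h
      cases h with
      | terminal h =>
        rw [h₂ _ _ _ ?_ h]
        dsimp only at hm
        subst hm
        rfl
    | eps h =>
      cases hq
      obtain ⟨i, h | h⟩ := h <;> cases h <;> obtain ⟨r, h₁, h₂⟩ := ih _ rfl <;>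
        refine ⟨_ :: r, h₁, ?_⟩ <;> intro m w m' hm h <;> dsimp only at hm
      · cases h with
        | opening hx h =>
          subst hm
          exact h₂ _ _ _ (instrAt_apply_nil hg i _ m).symm h
      · cases h with
        | closing hx h =>
          subst hm
          exact h₂ _ _ _ (instrAt_apply_nil hg i _ m).symm h
    | @memory_recall _ _ _ b _ _ _ h hb hx =>
      cases hq
      cases h
      obtain ⟨r, h₁, h₂⟩ := ih _ rfl
      refine ⟨_ :: r, h₁, ?_⟩
      intro m w m' hm h
      dsimp only at hm
      cases h with
      | ref hy h =>
        rw [h₂ _ _ _ ?_ h]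
        · subst hm
          exact hx.symm
        · subst hm
          exact (instrAt_apply_closed b _ m hy).symm
    | recall_failure h =>
      -- A failed recall leads to the trap, which is never left and is not final.
      obtain ⟨q', _, h⟩ := hf
      rw [toTMFA_trap hr rfl] at h
      cases h

theorem toTMFA_of_eval (hg : g.Injective) {m m' : Ξ → MemConfig α} {r w} (h : Eval m r w m')
    (hr : ∀ l ∈ r, l.vars ⊆ Set.range g) (q : σ) (hq : D.evalFrom q r ∈ D.accept) :
    ∃ c : (D.toTMFA g).Config, Relation.ReflTransGen (D.toTMFA g).Step ⟨some q, w, m ∘ g⟩ c ∧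
      c.input = [] ∧ c.state ∈ (D.toTMFA g).final := by
  classical
  induction h generalizing q with
  | nil m => exact ⟨_, .refl, rfl, q, hq, rfl⟩
  | @terminal m m' a r w h ih =>
    obtain ⟨c, h₁, h₂⟩ := ih (fun l hl => hr l (by simp [hl])) _ hq
    exact ⟨c, .head (.letter rfl) h₁, h₂⟩
  | @ref m m' x r w hx h ih =>
    obtain ⟨i, rfl⟩ := hr (.ref x) (by simp) rfl
    obtain ⟨c, h₁, h₂⟩ := ih (fun l hl => hr l (by simp [hl])) _ hq
    refine ⟨c, .head (.memory_recall (b := i) rfl (by simp [instrAt]) rfl) ?_, h₂⟩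
    convert h₁ using 2
    exact instrAt_apply_closed i _ m hx
  | @opening m m' x r w hx h ih =>
    obtain ⟨i, rfl⟩ := hr (.opening x) (by simp) rfl
    obtain ⟨c, h₁, h₂⟩ := ih (fun l hl => hr l (by simp [hl])) _ hq
    refine ⟨c, .head (.eps ⟨i, Or.inl rfl⟩) ?_, h₂⟩
    convert h₁ using 2
    exact instrAt_apply_nil hg i _ m
  | @closing m m' x r w hx h ih =>
    obtain ⟨i, rfl⟩ := hr (.closing x) (by simp) rfl
    obtain ⟨c, h₁, h₂⟩ := ih (fun l hl => hr l (by simp [hl])) _ hq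
    refine ⟨c, .head (.eps ⟨i, Or.inr rfl⟩) ?_, h₂⟩
    convert h₁ using 2
    exact instrAt_apply_nil hg i _ m

end DFA

theorem regexLanguages_subset_tmfaRejLanguages (α : Type u) (Ξ : Type v) :
    regexLanguages α Ξ ⊆ tmfaRejLanguages α := by
  rintro _ ⟨e | ⟨e, he⟩, rfl⟩
  · refine ⟨0, (⟨fun _ _ => (), (), ∅⟩ : DFA (RefLetter α Ξ) Unit).toTMFA Fin.elim0, ?_, ?_⟩
    · rintro ⟨_, _, h⟩
      cases h
    · ext w
      refine ⟨?_, fun h => absurd h (Language.notMem_zero w)⟩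
      rintro ⟨c, _, _, _, h, _⟩
      exact absurd h (by simp)
  · obtain ⟨σ, _, D, hD⟩ := e.isRegular_refLanguage
    have := e.finite_vars.to_subtype
    obtain ⟨k, ⟨f⟩⟩ := Finite.exists_equiv_fin e.vars
    let g : Fin k → Ξ := fun i => f.symm i
    have hg : g.Injective := Subtype.val_injective.comp f.symm.injective
    have hrange : Set.range g = e.vars := by
      ext x
      constructor
      · rintro ⟨i, rfl⟩
        exact (f.symm i).2
      · exact fun hx => ⟨f ⟨x, hx⟩, by simp [g]⟩
    refine ⟨k, D.toTMFA g, ?_, ?_⟩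
    · rintro ⟨_, _, h⟩
      cases h
    · ext w
      constructor
      · rintro ⟨c, hc, hi, hf⟩
        obtain ⟨r, hr, h⟩ := DFA.exists_of_toTMFA hg hc hi hf D.start rfl
        have hr' : r ∈ e.refLanguage := hD ▸ hr
        obtain ⟨w', m', hw, _⟩ := e.exists_eval he hr' emptyMem fun _ _ => rfl
        obtain rfl := h _ _ _ rfl hw
        exact ⟨r, hr', hw.deref_eq⟩
      · rintro ⟨r, hr, rfl⟩
        obtain ⟨w', m', hw, _⟩ := e.exists_eval he hr emptyMem fun _ _ => rfl
        rw [hw.deref_eq]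
        refine DFA.toTMFA_of_eval hg hw ?_ D.start (hD ▸ hr :)
        rw [hrange]
        exact RegexExpr.vars_subset_of_mem hr

/-! ### From regular sets of ref-words to regex -/

section

variable {α X : Type*}

theorem MemInstr.apply_unchanged_append (v w : List α) (m : MemConfig α) :
    MemInstr.unchanged.apply w (MemInstr.unchanged.apply v m) =
      MemInstr.unchanged.apply (v ++ w) m := by
  rcases m with ⟨u, _ | _⟩ <;> simp [MemInstr.apply]

theorem MemInstr.apply_unchanged_of_closed (v : List α) {m : MemConfig α}
    (h : m.isOpen = false) : MemInstr.unchanged.apply v m = m := by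
  rcases m with ⟨u, _ | _⟩
  · rfl
  · cases h

theorem eval_map_ref (l : List X) (m : X → MemConfig α) (hl : ∀ x ∈ l, (m x).isOpen = false) :
    Eval m (l.map RefLetter.ref) (l.flatMap fun x => (m x).content)
      (fun y => MemInstr.unchanged.apply (l.flatMap fun x => (m x).content) (m y)) := by
  induction l generalizing m with
  | nil => simpa using Eval.nil m
  | cons a l ih =>
    rw [List.map_cons, List.flatMap_cons]
    refine .ref (hl a (by simp)) ?_
    have := ih (fun y => MemInstr.unchanged.apply (m a).content (m y))
      fun x hx => by simpa using hl x (by simp [hx])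
    have h : (l.flatMap fun x => (MemInstr.unchanged.apply (m a).content (m x)).content) =
        l.flatMap fun x => (m x).content :=
      List.flatMap_congr fun x hx => by
        rw [MemInstr.apply_unchanged_of_closed _ (hl x (by simp [hx]))]
    simpa only [h, MemInstr.apply_unchanged_append] using this

-- An empty pair of brackets overwrites the content by the empty word. All pieces of a variable are
-- cleared in this way when it is opened anew.
open Classical in
theorem eval_reset (l : List X) (m : X → MemConfig α) (hl : ∀ x ∈ l, (m x).isOpen = false) :
    Eval m (l.flatMap fun x => [RefLetter.opening x, RefLetter.closing x]) []
      (fun y => if y ∈ l then ⟨[], false⟩ else m y) := by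
  induction l generalizing m with
  | nil => simpa using Eval.nil m
  | cons a l ih =>
    rw [List.flatMap_cons]
    refine .opening (hl a (by simp)) (.closing (by simp) ?_)
    have := ih (Function.update m a ⟨[], false⟩) fun x hx => by
      by_cases hxa : x = a
      · simp [hxa]
      · simpa [hxa] using hl x (by simp [hx])
    convert this using 1
    · simp
    · rfl
    · funext y
      by_cases hya : y = a <;> simp [hya]

end

namespace RegexExpr

variable {α : Type u} {Ξ : Type v}

/-- The ref-languages of well-formed expressions with variables in `V`, and the empty language. -/
def IsRefLanguage (V : Set Ξ) (l : Language (RefLetter α Ξ)) : Prop :=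
  l = 0 ∨ ∃ e : RegexExpr α Ξ, e.WellFormed ∧ e.vars ⊆ V ∧ e.refLanguage = l

/-- Since ∅ cannot be a subexpression, summands and factors equal to 0 are simplified away before an
expression is formed. -/
theorem rationallyClosed_isRefLanguage (V : Set Ξ) :
    Language.RationallyClosed (IsRefLanguage (α := α) V) where
  zero := Or.inl rfl
  one := Or.inr ⟨eps, trivial, Set.empty_subset V, rfl⟩
  add {l m} hl hm := by
    rcases hl with rfl | ⟨e, he, hv, rfl⟩
    · rwa [zero_add]
    rcases hm with rfl | ⟨e', he', hv', rfl⟩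
    · rw [add_zero]; exact Or.inr ⟨e, he, hv, rfl⟩
    · exact Or.inr ⟨alt e e', ⟨he, he'⟩, Set.union_subset hv hv', rfl⟩
  mul {l m} hl hm := by
    rcases hl with rfl | ⟨e, he, hv, rfl⟩
    · rw [zero_mul]; exact Or.inl rfl
    rcases hm with rfl | ⟨e', he', hv', rfl⟩
    · rw [mul_zero]; exact Or.inl rfl
    · exact Or.inr ⟨concat e e', ⟨he, he'⟩, Set.union_subset hv hv', rfl⟩
  kstar {l} hl := by
    rcases hl with rfl | ⟨e, he, hv, rfl⟩
    · rw [kstar_zero]; exact Or.inr ⟨eps, trivial, Set.empty_subset V, rfl⟩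
    · refine Or.inr ⟨alt eps (plus e), ⟨trivial, he⟩, Set.union_subset (Set.empty_subset V) hv, ?_⟩
      exact Language.one_add_self_mul_kstar_eq_kstar _

theorem IsRefLanguage.bind {V : Set Ξ} {l : Language (RefLetter α Ξ)} (hl : IsRefLanguage V l)
    {V' : Set Ξ} {x : Ξ} (hx : x ∉ V) (hV : V ⊆ V') (hx' : x ∈ V') :
    IsRefLanguage V' {r | ∃ s ∈ l, r = RefLetter.opening x :: (s ++ [RefLetter.closing x])} := by
  rcases hl with rfl | ⟨e, he, hv, rfl⟩
  · left
    ext r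
    refine ⟨?_, fun h => absurd h (Language.notMem_zero r)⟩
    rintro ⟨s, hs, -⟩
    exact absurd hs (Language.notMem_zero s)
  · exact Or.inr ⟨e.bind x, ⟨fun h => hx (hv h), he⟩,
      Set.union_subset (hv.trans hV) (Set.singleton_subset_iff.2 hx'), rfl⟩

end RegexExpr

namespace Language

theorem singleton_append {L : Type*} (u v : List L) :
    ({u ++ v} : Language L) = {u} * {v} := by
  ext w
  rw [mem_mul]
  constructor
  · rintro rfl
    exact ⟨u, rfl, v, rfl, rfl⟩
  · rintro ⟨_, rfl, _, rfl, rfl⟩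
    rfl

theorem RationallyClosed.flatMap {L ι : Type*} {C : Language L → Prop} (hC : RationallyClosed C)
    (l : List ι) (g : ι → List L) (h : ∀ i ∈ l, C {g i}) : C {l.flatMap g} := by
  induction l with
  | nil => exact hC.one
  | cons a l ih =>
    rw [List.flatMap_cons, singleton_append]
    exact hC.mul (h a (by simp)) (ih fun i hi => h i (by simp [hi]))

theorem RationallyClosed.of_finite {L : Type*} {C : Language L → Prop} (hC : RationallyClosed C)
    {l : Language L} (hl : Set.Finite (l : Set (List L))) (h : ∀ u ∈ l, C {u}) : C l := by
  have := hl.to_subtype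
  have h' := hC.exists (ι := {u // u ∈ l}) (f := fun u => {u.1}) fun u => h u.1 u.2
  have hl' : {w | ∃ u : {u // u ∈ l}, w ∈ ({u.1} : Language L)} = l := by
    ext w
    constructor
    · rintro ⟨⟨u, hu⟩, rfl⟩
      exact hu
    · exact fun hw => ⟨⟨w, hw⟩, rfl⟩
  exact hl' ▸ h'

end Language

/-! ### The stack machine that turns overlapping brackets into nested ones -/

/-- The control of the machine that rewrites ref-words into properly nested ones: a state of the
automaton for the original ref-words, the variables that have to be pushed back onto the stack, and
the variable that has to be pushed before. -/
structure Control (σ ι : Type*) where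
  state : σ
  pending : List ι
  nodup : pending.Nodup
  inserting : Option ι

namespace Control

/-- Pending variables are distinct, which leaves only finitely many lists of them. -/
instance {σ ι : Type*} [Finite σ] [Finite ι] : Finite (Control σ ι) := by
  classical
  have := Fintype.ofFinite ι
  have : Finite {l : List ι // l.Nodup} := inferInstance
  refine Finite.of_injective
    (fun c : Control σ ι => (c.state, (⟨c.pending, c.nodup⟩ : {l : List ι // l.Nodup}),
      c.inserting)) ?_
  rintro ⟨⟩ ⟨⟩ h
  simp_all

variable {α ι Ξ σ : Type*}

/-- The control at a state in which nothing is left to be pushed. -/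
def idle (q : σ) : Control σ ι := ⟨q, [], List.nodup_nil, none⟩

/-- The moves that keep the stack. -/
inductive Internal (D : DFA (RefLetter α ι) σ) (n : ℕ) (f : ι × ℕ → Ξ) (S : List ι) :
    Control σ ι → List (RefLetter α Ξ) → List (RefLetter α ι) → Control σ ι → Prop
  | terminal (q a) : Internal D n f S (idle q) [.terminal a] [.terminal a]
      (idle (D.step q (.terminal a)))
  | ref (q x) (hx : x ∉ S) : Internal D n f S (idle q)
      (((List.range n).map fun j => f (x, j)).map .ref) [.ref x] (idle (D.step q (.ref x)))
  | opening (q x) (hx : x ∉ S) : Internal D n f S (idle q)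
      (((List.range n).map fun j => f (x, j)).flatMap fun z => [.opening z, .closing z])
      [.opening x] ⟨D.step q (.opening x), [], List.nodup_nil, some x⟩

/-- The moves that push a variable. -/
inductive Push : Control σ ι → ι → Control σ ι → Prop
  | insert (q P h x) : Push ⟨q, P, h, some x⟩ x ⟨q, P, h, none⟩
  | restore (q P y h) : Push ⟨q, y :: P, h, none⟩ y ⟨q, P, h.of_cons, none⟩

/-- The moves that pop a variable. -/
inductive Pop (D : DFA (RefLetter α ι) σ) :
    ι → Control σ ι → List (RefLetter α ι) → Control σ ι → Prop
  | closing (q y) : Pop D y (idle q) [.closing y] (idle (D.step q (.closing y)))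
  | suspend (q P y h x) : Pop D y ⟨q, P, h.of_cons, some x⟩ [] ⟨q, y :: P, h, some x⟩

/-- The runs that lead to the empty stack. The two words are the nested ref-word that is written and
the ref-word that is read. The variable `y` at height `d` of the stack is written `f (y, d)`. -/
inductive Run (D : DFA (RefLetter α ι) σ) (n : ℕ) (f : ι × ℕ → Ξ) (cf : Control σ ι) :
    List ι → Control σ ι → List (RefLetter α Ξ) → List (RefLetter α ι) → Prop
  | nil : Run D n f cf [] cf [] []
  | internal {S c u v c' u' v'} (h : Internal D n f S c u v c') (h' : Run D n f cf S c' u' v') :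
      Run D n f cf S c (u ++ u') (v ++ v')
  | push {S c y c' u v} (hy : y ∉ S) (h : Push c y c') (h' : Run D n f cf (y :: S) c' u v) :
      Run D n f cf S c (.opening (f (y, S.length)) :: u) v
  | pop {S c y c' v u' v'} (h : Pop D y c v c') (h' : Run D n f cf S c' u' v') :
      Run D n f cf (y :: S) c (.closing (f (y, S.length)) :: u') (v ++ v')

/-- The runs that never go below the given stack and finally restore it. -/
inductive Nested (D : DFA (RefLetter α ι) σ) (n : ℕ) (f : ι × ℕ → Ξ) :
    List ι → Control σ ι → List (RefLetter α Ξ) → List (RefLetter α ι) → Control σ ι → Prop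
  | nil (S c) : Nested D n f S c [] [] c
  | internal {S c u v c' u' v' c''} (h : Internal D n f S c u v c')
      (h' : Nested D n f S c' u' v' c'') : Nested D n f S c (u ++ u') (v ++ v') c''
  | block {S y c c₁ c₂ c' c'' u v v₂ u' v'} (hy : y ∉ S) (h₁ : Push c y c₁)
      (h : Nested D n f (y :: S) c₁ u v c₂) (h₂ : Pop D y c₂ v₂ c')
      (h' : Nested D n f S c' u' v' c'') :
      Nested D n f S c
        (.opening (f (y, S.length)) :: (u ++ [.closing (f (y, S.length))]) ++ u')
        (v ++ v₂ ++ v') c''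

variable {D : DFA (RefLetter α ι) σ} {n : ℕ} {f : ι × ℕ → Ξ} {cf : Control σ ι}

theorem Nested.run {S c u v c' u' v'} (h : Nested D n f S c u v c') (h' : Run D n f cf S c' u' v') :
    Run D n f cf S c (u ++ u') (v ++ v') := by
  induction h generalizing u' v' with
  | nil => exact h'
  | internal h _ ih => simpa using Run.internal h (ih h')
  | block hy h₁ _ h₂ _ ih ih' => simpa using Run.push hy h₁ (ih (.pop h₂ (ih' h')))

/-- Runs to the empty stack, divided into nested parts. -/
def Layered (D : DFA (RefLetter α ι) σ) (n : ℕ) (f : ι × ℕ → Ξ) (cf : Control σ ι) :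
    List ι → Control σ ι → List (RefLetter α Ξ) → List (RefLetter α ι) → Prop
  | [], c, u, v => Nested D n f [] c u v cf
  | y :: S, c, u, v => ∃ u₁ v₁ c₁ v₂ c₂ u' v', Nested D n f (y :: S) c u₁ v₁ c₁ ∧
      Pop D y c₁ v₂ c₂ ∧ Layered D n f cf S c₂ u' v' ∧
      u = u₁ ++ .closing (f (y, S.length)) :: u' ∧ v = v₁ ++ v₂ ++ v'

theorem Layered.internal {S c u v c' u' v'} (h : Internal D n f S c u v c')
    (h' : Layered D n f cf S c' u' v') : Layered D n f cf S c (u ++ u') (v ++ v') := by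
  cases S with
  | nil => exact Nested.internal h h'
  | cons y S =>
    obtain ⟨u₁, v₁, c₁, v₂, c₂, u', v', h₁, h₂, h₃, rfl, rfl⟩ := h'
    exact ⟨_, _, _, _, _, _, _, .internal h h₁, h₂, h₃, by simp, by simp⟩

theorem Layered.block {S : List ι} {y} {c c₁ c₂ c' : Control σ ι} {u v v₂ u' v'} (hy : y ∉ S)
    (h₁ : Push c y c₁)
    (h : Nested D n f (y :: S) c₁ u v c₂) (h₂ : Pop D y c₂ v₂ c')
    (h' : Layered D n f cf S c' u' v') :
    Layered D n f cf S c (.opening (f (y, S.length)) :: (u ++ .closing (f (y, S.length)) :: u'))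
        (v ++ v₂ ++ v') := by
  cases S with
  | nil => simpa [Layered] using Nested.block hy h₁ h h₂ h'
  | cons z S =>
    obtain ⟨u₁, v₁, c₁, v₂, c₂, u', v', h₃, h₄, h₅, rfl, rfl⟩ := h'
    exact ⟨_, _, _, _, _, _, _, .block hy h₁ h h₂ h₃, h₄, h₅, by simp, by simp⟩

/-- The pop that matches a push is the end of the first layer of the remaining run; it closes the
block. -/
theorem Run.layered {S c u v} (h : Run D n f cf S c u v) : Layered D n f cf S c u v := by
  induction h with
  | nil => exact Nested.nil [] cf
  | internal h _ ih => exact ih.internal h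
  | push hy h _ ih =>
    obtain ⟨u₁, v₁, c₁, v₂, c₂, u', v', h₃, h₄, h₅, rfl, rfl⟩ := ih
    exact .block hy h h₃ h₄ h₅
  | pop h _ ih => exact ⟨_, _, _, _, _, _, _, .nil _ _, h, ih, rfl, rfl⟩

theorem nested_iff_run {c u v} : Nested D n f [] c u v cf ↔ Run D n f cf [] c u v :=
  ⟨fun h => by simpa using h.run .nil, fun h => h.layered⟩

theorem Run.evalFrom {S c u v} (h : Run D n f cf S c u v) : D.evalFrom c.state v = cf.state := by
  induction h with
  | nil => rfl
  | internal h _ ih =>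
    rw [DFA.evalFrom_of_append, ← ih]
    cases h <;> rfl
  | push hy h _ ih =>
    rw [← ih]
    cases h <;> rfl
  | pop h _ ih =>
    rw [DFA.evalFrom_of_append, ← ih]
    cases h <;> rfl

/-! #### The nested ref-words form a ref-language -/

/-- The words written by single internal moves. -/
def internalWords (D : DFA (RefLetter α ι) σ) (n : ℕ) (f : ι × ℕ → Ξ) (S : List ι)
    (c c' : Control σ ι) : Language (RefLetter α Ξ) :=
  {u | ∃ v, Internal D n f S c u v c'}

/-- The words written by nested runs. -/
def nestedWords (D : DFA (RefLetter α ι) σ) (n : ℕ) (f : ι × ℕ → Ξ) (S : List ι)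
    (c c' : Control σ ι) : Language (RefLetter α Ξ) :=
  {u | ∃ v, Nested D n f S c u v c'}

/-- The words written between a push of `y` that leads to `c₁` and a pop from `c₂`. -/
def blockWords (D : DFA (RefLetter α ι) σ) (n : ℕ) (f : ι × ℕ → Ξ) (S : List ι)
    (c c' : Control σ ι) (p : ι × Control σ ι × Control σ ι) : Language (RefLetter α Ξ) :=
  {u | (p.1 ∉ S ∧ Push c p.1 p.2.1 ∧ ∃ v, Pop D p.1 p.2.2 v c') ∧
    u ∈ ({r | ∃ s ∈ nestedWords D n f (p.1 :: S) p.2.1 p.2.2, r = .opening (f (p.1, S.length)) ::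
      (s ++ [.closing (f (p.1, S.length))])} : Language (RefLetter α Ξ))}

/-- The words of the moves of a nested run: internal moves and blocks. -/
def edges (D : DFA (RefLetter α ι) σ) (n : ℕ) (f : ι × ℕ → Ξ) (S : List ι) (c c' : Control σ ι) :
    Language (RefLetter α Ξ) :=
  internalWords D n f S c c' + ⨆ p, blockWords D n f S c c' p

theorem path_edges_iff {S : List ι} {c c' : Control σ ι} {u} :
    Language.Path (edges D n f S) c u c' ↔ u ∈ nestedWords D n f S c c' := by
  constructor
  · intro h
    induction h with
    | nil => exact ⟨_, .nil _ _⟩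
    | cons h _ ih =>
      obtain ⟨v', hv'⟩ := ih
      rcases h with ⟨v, hv⟩ | h
      · exact ⟨_, .internal hv hv'⟩
      · obtain ⟨⟨y, c₁, c₂⟩, ⟨hy, h₁, _, h₂⟩, s, ⟨v, hv⟩, rfl⟩ := Language.mem_iSup.1 h
        exact ⟨_, .block hy h₁ hv h₂ hv'⟩
  · rintro ⟨v, h⟩
    induction h with
    | nil => exact .nil _
    | @internal S c u v c₁ u' v' c' h _ ih =>
      have : u ∈ edges D n f S c c₁ := Or.inl ⟨_, h⟩
      exact .cons this ih
    | @block S y c c₁ c₂ c₃ c' u v v₂ u' v' hy h₁ h h₂ _ _ ih =>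
      have : .opening (f (y, S.length)) :: (u ++ [.closing (f (y, S.length))]) ∈
          edges D n f S c c₃ :=
          Or.inr (Language.mem_iSup.2 ⟨⟨_, _, _⟩, ⟨hy, h₁, _, h₂⟩, _, ⟨_, h⟩, rfl⟩)
      exact .cons this ih

theorem isRefLanguage_internal [Finite α] [Finite ι] (S : List ι) (c c' : Control σ ι) :
    RegexExpr.IsRefLanguage {z | ∃ x j, x ∉ S ∧ f (x, j) = z}
      (internalWords D n f S c c') := by
  have hC := RegexExpr.rationallyClosed_isRefLanguage (α := α) {z | ∃ x j, x ∉ S ∧ f (x, j) = z}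
  refine hC.of_finite ?_ ?_
  · refine (((Set.finite_range fun a : α => [RefLetter.terminal a]).union
      (Set.finite_range fun x : ι => ((List.range n).map fun j => f (x, j)).map RefLetter.ref)).union
      (Set.finite_range fun x : ι => ((List.range n).map fun j => f (x, j)).flatMap
        fun z => [RefLetter.opening z, RefLetter.closing z])).subset ?_
    rintro u ⟨v, h⟩
    cases h with
    | terminal q a => exact Or.inl (Or.inl ⟨a, rfl⟩)
    | ref q x => exact Or.inl (Or.inr ⟨x, rfl⟩)
    | opening q x => exact Or.inr ⟨x, rfl⟩
  · rintro u ⟨v, h⟩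
    cases h with
    | terminal q a => exact Or.inr ⟨.terminal a, trivial, Set.empty_subset _, rfl⟩
    | ref q x hx =>
      rw [← List.flatMap_singleton' (List.map _ _), List.flatMap_map]
      refine hC.flatMap _ _ fun z hz => ?_
      obtain ⟨j, -, rfl⟩ := List.mem_map.1 hz
      refine Or.inr ⟨.ref (f (x, j)), trivial, ?_, rfl⟩
      exact Set.singleton_subset_iff.2 ⟨x, j, hx, rfl⟩
    | opening q x hx =>
      refine hC.flatMap _ _ fun z hz => ?_
      obtain ⟨j, -, rfl⟩ := List.mem_map.1 hz
      refine Or.inr ⟨.bind (f (x, j)) .eps, ⟨Set.notMem_empty _, trivial⟩, ?_, ?_⟩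
      · exact Set.union_subset (Set.empty_subset _)
          (Set.singleton_subset_iff.2 ⟨x, j, hx, rfl⟩)
      · ext r
        constructor
        · rintro ⟨_, rfl, rfl⟩
          rfl
        · rintro rfl
          exact ⟨_, rfl, rfl⟩

/-- A nested run over `S` is a path of internal moves and blocks, and a block is a binding around a
nested run over `y :: S`. Inside the block only pieces of variables outside `y :: S` are written, so
the bound piece of `y` does not occur there and the binding is well-formed. -/
theorem isRefLanguage_nested [Finite α] [Finite ι] [Finite σ] (hf : f.Injective) (S : List ι)
    (hS : S.Nodup) (c c' : Control σ ι) :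
    RegexExpr.IsRefLanguage {z | ∃ x j, x ∉ S ∧ f (x, j) = z}
      (nestedWords D n f S c c') := by
  have := Fintype.ofFinite ι
  -- The number `k` bounds the room left above the stack. At 0 the stack would be longer than the
  -- number of variables, which distinctness forbids.
  obtain ⟨k, hk⟩ : ∃ k, Fintype.card ι < k + S.length :=
    ⟨Fintype.card ι + 1, by omega⟩
  induction k generalizing S c c' with
  | zero => have := hS.length_le_card; omega
  | succ k ih =>
    have hC := RegexExpr.rationallyClosed_isRefLanguage (α := α) {z | ∃ x j, x ∉ S ∧ f (x, j) = z}
    have h : RegexExpr.IsRefLanguage {z | ∃ x j, x ∉ S ∧ f (x, j) = z}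
        {u | Language.Path (edges D n f S) c u c'} := by
      refine hC.path (E := edges D n f S)
        (fun c c' => hC.add (isRefLanguage_internal S c c') ?_) c c'
      refine hC.iSup fun ⟨y, c₁, c₂⟩ => ?_
      by_cases hy : y ∈ S
      · exact Or.inl (Language.ext fun u =>
          ⟨fun h => absurd hy h.1.1, fun h => absurd h (Language.notMem_zero u)⟩)
      · refine hC.and (RegexExpr.IsRefLanguage.bind
          (ih (y :: S) (List.nodup_cons.2 ⟨hy, hS⟩) c₁ c₂ (by simp; omega)) ?_ ?_ ?_)
        · rintro ⟨x, j, hx, h⟩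
          have := congrArg Prod.fst (hf h)
          simp_all
        · rintro z ⟨x, j, hx, rfl⟩
          exact ⟨x, j, fun h => hx (by simp [h]), rfl⟩
        · exact ⟨y, _, hy, rfl⟩
    have h' : {u | Language.Path (edges D n f S) c u c'} = nestedWords D n f S c c' :=
      Language.ext fun u => path_edges_iff
    exact h' ▸ h

end Control

/-! ### The nested ref-word denotes the same word -/

namespace Control

variable {α ι Ξ σ : Type*} {D : DFA (RefLetter α ι) σ} {n : ℕ} {f : ι × ℕ → Ξ}
  {cf : Control σ ι}

/-- The variable `x` occurs at height `j` of the stack `S`. -/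
def At : List ι → ι → ℕ → Prop
  | [], _, _ => False
  | y :: S, x, j => (x = y ∧ j = S.length) ∨ At S x j

theorem At.mem {S : List ι} {x : ι} {j : ℕ} (h : At S x j) : x ∈ S := by
  induction S with
  | nil => exact h.elim
  | cons y S ih =>
    rcases h with ⟨rfl, -⟩ | h
    · simp
    · simp [ih h]

theorem At.lt {S : List ι} {x : ι} {j : ℕ} (h : At S x j) : j < S.length := by
  induction S with
  | nil => exact h.elim
  | cons y S ih =>
    rcases h with ⟨-, rfl⟩ | h
    · simp
    · simpa using (ih h).trans (Nat.lt_succ_self _)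

theorem exists_at {S : List ι} {x : ι} (h : x ∈ S) : ∃ j, At S x j := by
  induction S with
  | nil => simp at h
  | cons y S ih =>
    rcases List.mem_cons.1 h with rfl | h
    · exact ⟨_, Or.inl ⟨rfl, rfl⟩⟩
    · exact (ih h).imp fun j hj => Or.inr hj

theorem At.unique {S : List ι} (hS : S.Nodup) {x : ι} {i j : ℕ} (h : At S x i) (h' : At S x j) :
    i = j := by
  induction S with
  | nil => exact h.elim
  | cons y S ih =>
    obtain ⟨hy, hS⟩ := List.nodup_cons.1 hS
    rcases h with ⟨rfl, rfl⟩ | h <;> rcases h' with ⟨h', rfl⟩ | h'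
    · rfl
    · exact absurd h'.mem hy
    · exact absurd (h' ▸ h.mem) hy
    · exact ih hS h h'

/-- The memories `m'` represent the memories `m` in such a way that the content of `x` is divided
into the contents of the variables `f (x, j)`, where `S` is the stack, `P` contains the variables
that are temporarily removed from the stack, and `o` the variable that will be pushed next. -/
structure Represents (n : ℕ) (f : ι × ℕ → Ξ) (S P : List ι) (o : Option ι)
    (m : ι → MemConfig α) (m' : Ξ → MemConfig α) : Prop where
  nodup : (o.toList ++ (P ++ S)).Nodup
  isOpen : ∀ x, (m x).isOpen = true ↔ x ∈ o.toList ++ (P ++ S)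
  piece : ∀ x j, (m' (f (x, j))).isOpen = true ↔ At S x j
  content : ∀ x, (m x).content = (List.range n).flatMap fun j => (m' (f (x, j))).content
  stack_empty : ∀ x j, At S x j → ∀ i, j < i → i < n → (m' (f (x, i))).content = []
  pending_empty : ∀ i x, P[i]? = some x → ∀ j, S.length + o.toList.length + i ≤ j →
    j < n → (m' (f (x, j))).content = []
  inserting_empty : ∀ x ∈ o, ∀ j, j < n → (m' (f (x, j))).content = []

/-- All pieces after the k-th are empty, so lengthening the k-th piece lengthens the whole
concatenation at its end. -/
theorem flatMap_range_update {β : Type*} {n k : ℕ} (hk : k < n) (g h : ℕ → List β) (v : List β)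
    (hg : ∀ i, k < i → i < n → g i = []) (hkh : h k = g k ++ v) (hh : ∀ i ≠ k, h i = g i) :
    (List.range n).flatMap h = (List.range n).flatMap g ++ v := by
  induction n with
  | zero => omega
  | succ n ih =>
    rw [List.range_succ, List.flatMap_append, List.flatMap_append]
    rcases Nat.lt_succ_iff_lt_or_eq.1 hk with hk | rfl
    · rw [ih hk fun i hi hi' => hg i hi (hi'.trans (Nat.lt_succ_self n))]
      simp [hh n hk.ne', hg n hk]
    · have : (List.range k).flatMap h = (List.range k).flatMap g :=
        List.flatMap_congr fun i hi => hh i (List.mem_range.1 hi).ne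
      simp [this, hkh]

namespace Represents

variable {S P : List ι} {o : Option ι} {m : ι → MemConfig α} {m' : Ξ → MemConfig α}

theorem piece_closed (h : Represents n f S P o m m') {x : ι} (hx : x ∉ S) (j : ℕ) :
    (m' (f (x, j))).isOpen = false := by
  rw [← Bool.not_eq_true, h.piece]
  exact fun hj => hx hj.mem

/-- Both sides read the same word. -/
theorem feed (h : Represents n f S [] none m m') (hn : S.length ≤ n) (v : List α) :
    Represents n f S [] none (fun x => MemInstr.unchanged.apply v (m x))
      (fun y => MemInstr.unchanged.apply v (m' y)) where
  nodup := h.nodup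
  isOpen x := by simpa using h.isOpen x
  piece x j := by simpa using h.piece x j
  content x := by
    have hx := h.isOpen x
    simp only [Option.toList_none, List.nil_append] at hx
    simp only [MemInstr.apply_unchanged_content]
    by_cases hxS : x ∈ S
    -- Among the pieces of an open variable only the one at its current height grows, and those
    -- above it are still empty.
    · obtain ⟨j, hj⟩ := exists_at hxS
      rw [if_pos (hx.2 hxS), h.content]
      refine (flatMap_range_update (hj.lt.trans_le hn) _ _ v (h.stack_empty x j hj) ?_ ?_).symm
      · rw [if_pos ((h.piece x j).2 hj)]
      · intro i hi
        rw [if_neg]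
        rw [h.piece]
        exact fun hi' => hi (hi'.unique (by simpa using h.nodup) hj)
    · rw [if_neg (fun h' => hxS (hx.1 h')), h.content]
      refine List.flatMap_congr fun j _ => ?_
      rw [h.piece_closed hxS]
      rfl
  stack_empty x j hj i hi hn := by
    have : ¬ (m' (f (x, i))).isOpen = true := by
      rw [h.piece]
      exact fun hi' => hi.ne (hj.unique (by simpa using h.nodup) hi')
    rw [MemInstr.apply_unchanged_content, if_neg this]
    exact h.stack_empty x j hj i hi hn
  pending_empty := by simp
  inserting_empty := by simp

open Classical in
theorem opening (hf : f.Injective) (h : Represents n f S [] none m m') {x : ι} (hx : x ∉ S) :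
    Represents n f S [] (some x) (Function.update m x ⟨[], true⟩)
      (fun y => if y ∈ (List.range n).map fun j => f (x, j) then ⟨[], false⟩ else m' y) := by
  have hmem : ∀ z j, f (z, j) ∈ ((List.range n).map fun j => f (x, j)) ↔ z = x ∧ j < n := by
    intro z j
    simp only [List.mem_map, List.mem_range]
    constructor
    · rintro ⟨i, hi, h⟩
      obtain ⟨rfl, rfl⟩ := Prod.ext_iff.1 (hf h)
      exact ⟨rfl, hi⟩
    · rintro ⟨rfl, hj⟩
      exact ⟨j, hj, rfl⟩
  refine ⟨by have := h.nodup; simp_all, ?_, ?_, ?_, ?_, by simp, ?_⟩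
  · intro z
    have := h.isOpen z
    by_cases hzx : z = x <;> simp_all
  · intro z j
    have := h.piece z j
    by_cases hz : z = x ∧ j < n
    · obtain ⟨rfl, hj⟩ := hz
      rw [if_pos ((hmem z j).2 ⟨rfl, hj⟩)]
      simpa using fun h' : At S z j => hx h'.mem
    · rwa [if_neg (mt (hmem z j).1 hz)]
  · intro z
    by_cases hzx : z = x
    · subst hzx
      rw [Function.update_self]
      symm
      rw [List.flatMap_eq_nil_iff]
      intro j hj
      rw [if_pos ((hmem z j).2 ⟨rfl, List.mem_range.1 hj⟩)]
    · rw [Function.update_of_ne hzx, h.content]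
      refine List.flatMap_congr fun j _ => ?_
      rw [if_neg (mt (hmem z j).1 fun h => hzx h.1)]
  · intro z j hj i hi hn
    have hzx : z ≠ x := fun h => hx (h ▸ hj.mem)
    rw [if_neg (mt (hmem z i).1 fun h => hzx h.1)]
    exact h.stack_empty z j hj i hi hn
  · intro z hz j hn
    obtain rfl : x = z := by simpa using hz
    rw [if_pos ((hmem x j).2 ⟨rfl, hn⟩)]

open Classical in
theorem closing (hf : f.Injective) {y : ι} (h : Represents n f (y :: S) [] none m m') :
    Represents n f S [] none (Function.update m y ⟨(m y).content, false⟩)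
      (Function.update m' (f (y, S.length)) ⟨(m' (f (y, S.length))).content, false⟩) := by
  have hy : y ∉ S := by have := h.nodup; simp_all
  have hc : ∀ z, (Function.update m' (f (y, S.length))
      ⟨(m' (f (y, S.length))).content, false⟩ z).content = (m' z).content := by
    intro z
    by_cases hz : z = f (y, S.length)
    · subst hz; simp
    · simp [hz]
  refine ⟨by have := h.nodup; simp_all, ?_, ?_, ?_, ?_, by simp, by simp⟩
  · intro x
    by_cases hxy : x = y
    · subst hxy; simpa using hy
    · simpa [hxy] using h.isOpen x
  · intro x j
    have := h.piece x j
    by_cases hxy : x = y ∧ j = S.length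
    · obtain ⟨rfl, rfl⟩ := hxy
      simpa using fun h' : At S x _ => hy h'.mem
    · have hne : f (x, j) ≠ f (y, S.length) := fun h' => hxy (by simpa using hf h')
      simpa [hne, At, hxy] using this
  · intro x
    simp only [hc]
    rw [← h.content]
    by_cases hxy : x = y
    · subst hxy; simp
    · simp [hxy]
  · intro x j hj i hi hn
    rw [hc]
    exact h.stack_empty x j (Or.inr hj) i hi hn

-- The variable `y` stays open in `m`; only its current piece ends. It will be pushed back at a
-- larger height, since `x` is inserted below it, and the pieces from there on are empty.
open Classical in
theorem suspend (hf : f.Injective) {y x : ι} (h : Represents n f (y :: S) P (some x) m m') :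
    Represents n f S (y :: P) (some x) m
      (Function.update m' (f (y, S.length)) ⟨(m' (f (y, S.length))).content, false⟩) := by
  have hy : y ∉ S := (List.nodup_cons.1 h.nodup.of_append_right.of_append_right).1
  have hc : ∀ z, (Function.update m' (f (y, S.length))
      ⟨(m' (f (y, S.length))).content, false⟩ z).content = (m' z).content := by
    intro z
    by_cases hz : z = f (y, S.length)
    · subst hz; simp
    · simp [hz]
  have hperm : ((some x).toList ++ (P ++ y :: S)).Perm ((some x).toList ++ (y :: P ++ S)) :=
    List.Perm.append_left _ List.perm_middle
  refine ⟨hperm.nodup_iff.1 h.nodup, fun z => (h.isOpen z).trans hperm.mem_iff, ?_, ?_, ?_, ?_, ?_⟩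
  · intro x j
    have := h.piece x j
    by_cases hxy : x = y ∧ j = S.length
    · obtain ⟨rfl, rfl⟩ := hxy
      simpa using fun h' : At S x _ => hy h'.mem
    · have hne : f (x, j) ≠ f (y, S.length) := fun h' => hxy (by simpa using hf h')
      simpa [hne, At, hxy] using this
  · intro x
    simp only [hc]
    exact h.content x
  · intro x j hj i hi hn
    rw [hc]
    exact h.stack_empty x j (Or.inr hj) i hi hn
  · intro i z hz j hj hn
    rw [hc]
    rcases i with _ | i
    · obtain rfl : y = z := by simpa using hz
      refine h.stack_empty y S.length (Or.inl ⟨rfl, rfl⟩) j ?_ hn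
      simp at hj
      omega
    · refine h.pending_empty i z (by simpa using hz) j ?_ hn
      simp at hj ⊢
      omega
  · intro z hz j hn
    rw [hc]
    exact h.inserting_empty z hz j hn

-- This serves both kinds of push. Opening a piece erases its content, which is harmless because the
-- piece is empty by `hy`.
open Classical in
theorem push (hf : f.Injective) {y : ι} {P' : List ι} (hn : S.length < n)
    (h : Represents n f S P o m m') (hP : (o.toList ++ (P ++ S)).Perm (P' ++ y :: S))
    (hy : ∀ j, S.length ≤ j → j < n → (m' (f (y, j))).content = [])
    (hP' : ∀ i x, P'[i]? = some x → ∀ j, S.length + 1 + i ≤ j → j < n →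
      (m' (f (x, j))).content = []) :
    Represents n f (y :: S) P' none m (Function.update m' (f (y, S.length)) ⟨[], true⟩) := by
  have hyS : y ∉ S := (List.nodup_cons.1 (hP.nodup_iff.1 h.nodup).of_append_right).1
  have hc : ∀ z, (Function.update m' (f (y, S.length)) ⟨[], true⟩ z).content =
      (m' z).content := by
    intro z
    by_cases hz : z = f (y, S.length)
    · subst hz; simp [hy S.length le_rfl hn]
    · simp [hz]
  refine ⟨hP.nodup_iff.1 h.nodup, fun z => (h.isOpen z).trans hP.mem_iff, ?_, ?_, ?_, ?_, by simp⟩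
  · intro x j
    have := h.piece x j
    by_cases hxy : x = y ∧ j = S.length
    · obtain ⟨rfl, rfl⟩ := hxy
      simp [At]
    · have hne : f (x, j) ≠ f (y, S.length) := fun h' => hxy (by simpa using hf h')
      simpa [hne, At, hxy] using this
  · intro x
    simp only [hc]
    exact h.content x
  · intro x j hj i hi hn
    rw [hc]
    rcases hj with ⟨rfl, rfl⟩ | hj
    · exact hy i hi.le hn
    · exact h.stack_empty x j hj i hi hn
  · intro i z hz j hj hn
    rw [hc]
    exact hP' i z hz j (by simpa using hj) hn

end Represents

theorem represents_empty (n : ℕ) (f : ι × ℕ → Ξ) :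
    Represents n f [] [] none (emptyMem : ι → MemConfig α) emptyMem := by
  refine ⟨by simp, by simp [emptyMem], by simp [emptyMem, At], ?_, ?_, by simp, by simp⟩
  · intro x
    symm
    simp [emptyMem]
  · rintro x j ⟨⟩

/-- The invariant `Represents` survives every move, whichever variables the run chooses to suspend.
The choice matters only for the existence of a run. -/
theorem Run.eval (hf : f.Injective) (hn : ∀ S : List ι, S.Nodup → S.length ≤ n) {S c u v}
    (h : Run D n f cf S c u v) {m m₁ : ι → MemConfig α} {m' : Ξ → MemConfig α} {w}
    (hm : Represents n f S c.pending c.inserting m m') (hv : Eval m v w m₁) :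
    ∃ m₁', Eval m' u w m₁' := by
  classical
  induction h generalizing m m' w with
  | nil => cases hv; exact ⟨_, .nil _⟩
  | @internal S c u v c' u' v' h _ ih =>
    cases h with
    | terminal q a =>
      cases hv with
      | terminal hv =>
        obtain ⟨m₁', h⟩ := ih (hm.feed (hn S hm.nodup.of_append_right.of_append_right) [a]) hv
        exact ⟨m₁', .terminal h⟩
    | ref q x hx =>
      cases hv with
      | ref hxc hv =>
        obtain ⟨m₁', h⟩ := ih (hm.feed (hn S hm.nodup.of_append_right.of_append_right) _) hv
        refine ⟨m₁', Eval.append ?_ h⟩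
        have := eval_map_ref ((List.range n).map fun j => f (x, j)) m' fun z hz => by
          obtain ⟨j, -, rfl⟩ := List.mem_map.1 hz
          exact hm.piece_closed hx j
        rwa [List.flatMap_map, ← hm.content] at this
    | opening q x hx =>
      cases hv with
      | opening hxc hv =>
        obtain ⟨m₁', h⟩ := ih (hm.opening hf hx) hv
        refine ⟨m₁', Eval.append (w := []) ?_ h⟩
        refine eval_reset _ m' fun z hz => ?_
        obtain ⟨j, -, rfl⟩ := List.mem_map.1 hz
        exact hm.piece_closed hx j
  | @push S c y c' u v hy h _ ih =>
    suffices hm' : Represents n f (y :: S) c'.pending c'.inserting m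
        (Function.update m' (f (y, S.length)) ⟨[], true⟩) by
      obtain ⟨m₁', h⟩ := ih hm' hv
      exact ⟨m₁', .opening (hm.piece_closed hy _) h⟩
    have hS : S.length < n :=
      hn (y :: S) (List.nodup_cons.2 ⟨hy, hm.nodup.of_append_right.of_append_right⟩)
    cases h with
    | insert q P h x =>
      refine hm.push hf hS ?_ (fun j _ hj => hm.inserting_empty y rfl j hj) ?_
      · change (y :: (P ++ S)).Perm (P ++ y :: S)
        exact List.perm_middle.symm
      · intro i x hx j hj
        exact hm.pending_empty i x hx j (by simpa using hj)
    | restore q P y h =>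
      refine hm.push hf hS ?_ (fun j hj => hm.pending_empty 0 y rfl j (by simpa using hj)) ?_
      · exact List.perm_middle.symm
      · intro i x hx j hj
        exact hm.pending_empty (i + 1) x (by simpa using hx) j (by simp; omega)
  | @pop S c y c' v u' v' h _ ih =>
    cases h with
    | closing q y =>
      cases hv with
      | closing hyo hv =>
        obtain ⟨m₁', h⟩ := ih (hm.closing hf) hv
        exact ⟨m₁', .closing ((hm.piece _ _).2 (Or.inl ⟨rfl, rfl⟩)) h⟩
    | suspend q P y h x =>
      obtain ⟨m₁', h⟩ := ih (hm.suspend hf) hv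
      exact ⟨m₁', .closing ((hm.piece _ _).2 (Or.inl ⟨rfl, rfl⟩)) h⟩

/-! #### Every evaluable ref-word is read by a run -/

open Classical in
/-- The number of letters in front of the first closing bracket of `x`. -/
noncomputable def closeTime : List (RefLetter α ι) → ι → ℕ
  | [], _ => 0
  | l :: r, x => if l = .closing x then 0 else closeTime r x + 1

/-- Runs are built from their end, so the later configuration is the hypothesis. The list `R` is
pushed head first and therefore appears reversed on the stack. -/
theorem Run.restore {q : σ} {u v} {R S : List ι} (hR : (R ++ S).Nodup)
    (h : Run D n f cf (R.reverse ++ S) (idle q) u v) :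
    ∃ u', Run D n f cf S ⟨q, R, hR.of_append_left, none⟩ u' v := by
  induction R generalizing S with
  | nil => exact ⟨u, h⟩
  | cons y R ih =>
    obtain ⟨u', h'⟩ := ih (S := y :: S) (List.perm_middle.nodup_iff.2 hR) (by simpa using h)
    refine ⟨_, .push ?_ (.restore q R y _) h'⟩
    have := hR
    simp_all

theorem Run.suspend {q : σ} {x : ι} {u v} {A P S : List ι} (hA : (A.reverse ++ P).Nodup)
    (h : Run D n f cf S ⟨q, A.reverse ++ P, hA, some x⟩ u v) :
    ∃ u', Run D n f cf (A ++ S) ⟨q, P, hA.of_append_right, some x⟩ u' v := by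
  induction A generalizing P with
  | nil => exact ⟨u, h⟩
  | cons y A ih =>
    obtain ⟨u', h'⟩ := ih (P := y :: P) (by simpa using hA) (by simpa using h)
    exact ⟨_, .pop (.suspend q P y _ x) h'⟩

/-- The variables in `A` are suspended, `x` is pushed, and `A` is restored; being reversed twice, it
regains its order. -/
theorem Run.insert {q : σ} {x : ι} {u v} {A S : List ι} (hx : (x :: (A ++ S)).Nodup)
    (h : Run D n f cf (A ++ x :: S) (idle q) u v) :
    ∃ u', Run D n f cf (A ++ S) ⟨q, [], List.nodup_nil, some x⟩ u' v := by
  have hx' : (A.reverse ++ x :: S).Nodup :=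
    (((List.reverse_perm A).append_right _).trans List.perm_middle).nodup_iff.2 hx
  obtain ⟨u', h'⟩ := Run.restore hx' (by simpa using h)
  have hA : A.reverse.Nodup := hx'.of_append_left
  refine Run.suspend (P := []) (by simpa using hA) (u := .opening (f (x, S.length)) :: u') ?_
  simp only [List.append_nil]
  exact .push (fun h => by simp_all) (.insert _ _ _ _) h'

theorem exists_split {t : ι → ℕ} {S : List ι} (hS : S.Pairwise fun x y => t x ≤ t y) (k : ℕ) :
    ∃ A B, S = A ++ B ∧ (∀ a ∈ A, t a ≤ k) ∧ ∀ b ∈ B, k ≤ t b := by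
  induction S with
  | nil => exact ⟨[], [], rfl, by simp, by simp⟩
  | cons y S ih =>
    obtain ⟨hy, hS⟩ := List.pairwise_cons.1 hS
    by_cases h : t y ≤ k
    · obtain ⟨A, B, rfl, hA, hB⟩ := ih hS
      exact ⟨y :: A, B, rfl, by simpa using ⟨h, hA⟩, hB⟩
    · refine ⟨[], y :: S, rfl, by simp, ?_⟩
      intro b hb
      rcases List.mem_cons.1 hb with rfl | hb
      · omega
      · have := hy b hb
        omega

/-- With the stack sorted by the next closing bracket, a variable to be closed is always on top, and
a newly opened one is inserted between those that close before it and those that close after it. -/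
theorem exists_run {m m' : ι → MemConfig α} {r w} (h : Eval m r w m')
    (hm' : ∀ x, (m' x).isOpen = false) {S : List ι} (hS : S.Nodup)
    (hm : ∀ x, (m x).isOpen = true ↔ x ∈ S)
    (hs : S.Pairwise fun x y => closeTime r x ≤ closeTime r y) (q : σ) :
    ∃ u, Run D n f (idle (D.evalFrom q r)) S (idle q) u r := by
  induction h generalizing S q with
  | nil m =>
    obtain rfl : S = [] := List.eq_nil_iff_forall_not_mem.2 fun x hx => by
      simpa [hm'] using (hm x).2 hx
    exact ⟨_, .nil⟩
  | terminal h ih =>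
    obtain ⟨u, hu⟩ := ih hm' hS (by simpa using hm) (by simpa [closeTime] using hs) (D.step q _)
    exact ⟨_, .internal (.terminal q _) hu⟩
  | ref hx h ih =>
    obtain ⟨u, hu⟩ := ih hm' hS (by simpa using hm) (by simpa [closeTime] using hs) (D.step q _)
    exact ⟨_, .internal (.ref q _ fun h => by simp [(hm _).2 h] at hx) hu⟩
  | @opening m m' x r w hx h ih =>
    have hxS : x ∉ S := fun h => by simp [(hm _).2 h] at hx
    replace hs : S.Pairwise fun x y => closeTime r x ≤ closeTime r y := by
      simpa [closeTime] using hs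
    obtain ⟨A, B, rfl, hA, hB⟩ := exists_split hs (closeTime r x)
    obtain ⟨u, hu⟩ := ih (S := A ++ x :: B) hm'
      (List.perm_middle.nodup_iff.2 (List.nodup_cons.2 ⟨hxS, hS⟩))
      (fun y => by
        by_cases hy : y = x
        · simp [hy]
        · simpa [hy] using hm y)
      (by
        rw [List.pairwise_append] at hs ⊢
        refine ⟨hs.1, List.pairwise_cons.2 ⟨hB, hs.2.1⟩, ?_⟩
        intro a ha b hb
        rcases List.mem_cons.1 hb with rfl | hb
        · exact hA a ha
        · exact hs.2.2 a ha b hb) (D.step q (.opening x))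
    obtain ⟨u', hu'⟩ := hu.insert (List.nodup_cons.2 ⟨hxS, hS⟩)
    exact ⟨_, .internal (.opening q x hxS) hu'⟩
  | @closing m m' x r w hx h ih =>
    have hxS : x ∈ S := (hm x).1 hx
    cases S with
    | nil => simp at hxS
    | cons y S =>
      obtain ⟨hyS, hS'⟩ := List.nodup_cons.1 hS
      obtain ⟨hy, hs'⟩ := List.pairwise_cons.1 hs
      -- The closing time of `x` is 0 here, so that of the top variable is 0 as well.
      obtain rfl : x = y := by
        rcases List.mem_cons.1 hxS with rfl | hxS
        · rfl
        · have := hy x hxS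
          by_contra hne
          simp [closeTime, hne] at this
      obtain ⟨u, hu⟩ := ih (S := S) hm' hS'
        (fun z => by
          by_cases hz : z = x
          · simp [hz, hyS]
          · simpa [hz] using hm z)
        (hs'.imp_of_mem fun {a b} ha hb h => by
          have ha' : x ≠ a := fun h => hyS (h ▸ ha)
          have hb' : x ≠ b := fun h => hyS (h ▸ hb)
          simpa [closeTime, ha', hb'] using h) (D.step q (.closing x))
      exact ⟨_, .pop (.closing q x) hu⟩

end Control

/-- The languages denoted by regular sets of ref-words over the variables `ι` in which every bracket
is used properly and finally closed, though brackets of different variables may overlap. -/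
def IsMemoryRegular {α : Type u} (ι : Type v) (l : Language α) : Prop :=
  ∃ K : Language (RefLetter α ι), K.IsRegular ∧
    (∀ r ∈ K, ∃ w m, Eval emptyMem r w m ∧ ∀ x, (m x).isOpen = false) ∧
    ∀ w, w ∈ l ↔ ∃ r ∈ K, ∃ m, Eval emptyMem r w m

theorem IsMemoryRegular.mem_regexLanguages {α : Type u} {ι : Type*} {Ξ : Type v} [Finite α]
    [Finite ι] [Infinite Ξ] {l : Language α} (h : IsMemoryRegular ι l) :
    l ∈ regexLanguages α Ξ := by
  obtain ⟨K, ⟨σ, _, D, rfl⟩, hK, hl⟩ := h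
  have := Fintype.ofFinite ι
  obtain ⟨f⟩ : Nonempty (ι × ℕ ↪ Ξ) := by
    obtain ⟨g, hg⟩ := exists_injective_nat (ι × ℕ)
    exact ⟨(⟨g, hg⟩ : ι × ℕ ↪ ℕ).trans (Infinite.natEmbedding Ξ)⟩
  have hn : ∀ S : List ι, S.Nodup → S.length ≤ Fintype.card ι := fun S hS => hS.length_le_card
  set n := Fintype.card ι
  let R : Language (RefLetter α Ξ) :=
    {u | ∃ q : σ, q ∈ D.accept ∧ u ∈ Control.nestedWords D n f [] (.idle D.start) (.idle q)}
  have hR : RegexExpr.IsRefLanguage Set.univ R := by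
    have hC := RegexExpr.rationallyClosed_isRefLanguage (α := α) (Set.univ : Set Ξ)
    refine hC.exists fun q => hC.and ?_
    rcases Control.isRefLanguage_nested (D := D) (n := n) f.injective [] List.nodup_nil
      (.idle D.start) (.idle q) with h | ⟨e, he, -, h⟩
    · exact Or.inl h
    · exact Or.inr ⟨e, he, Set.subset_univ _, h⟩
  have key : ∀ w, w ∈ l ↔ ∃ u ∈ R, deref u = w := by
    intro w
    rw [hl]
    constructor
    · rintro ⟨r, hr, m, hm⟩
      obtain ⟨w', m', hm', hcl⟩ := hK r hr
      obtain ⟨rfl, rfl⟩ := hm.unique hm'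
      obtain ⟨u, hu⟩ := Control.exists_run (D := D) (n := n) (f := f) hm hcl (S := [])
        List.nodup_nil (by simp [emptyMem]) (by simp) D.start
      obtain ⟨m₁, h₁⟩ := hu.eval f.injective hn (Control.represents_empty n f) hm
      exact ⟨u, ⟨_, hr, r, Control.nested_iff_run.2 hu⟩, h₁.deref_eq⟩
    · rintro ⟨u, ⟨q, hq, r, hu⟩, rfl⟩
      -- No control over the choices of the run is needed here: the word it reads lies in the given
      -- regular set, hence is evaluable, and has the same value.
      have hu := Control.nested_iff_run.1 hu
      have hr : r ∈ D.accepts := by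
        have := hu.evalFrom
        rw [DFA.mem_accepts, DFA.eval]
        exact this ▸ hq
      obtain ⟨w, m, hm, -⟩ := hK r hr
      obtain ⟨m₁, h₁⟩ := hu.eval f.injective hn (Control.represents_empty n f) hm
      rw [h₁.deref_eq]
      exact ⟨r, hr, m, hm⟩
  rcases hR with h | ⟨e, he, -, h⟩
  · refine ⟨.empty, Language.ext fun w => ?_⟩
    rw [key, h]
    exact ⟨fun h => absurd h (Language.notMem_zero w),
      fun ⟨u, hu, _⟩ => absurd hu (Language.notMem_zero u)⟩
  · refine ⟨.expr e he, Language.ext fun w => ?_⟩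
    rw [key, ← h]
    rfl

/-! ### From memory automata to regular sets of ref-words -/

section

variable {α : Type*} {k : ℕ}

instance : Finite MemInstr := by
  refine Finite.of_surjective
    (![.opening, .closing, .reset, .unchanged] : Fin 4 → MemInstr) fun s => ?_
  cases s
  exacts [⟨0, rfl⟩, ⟨1, rfl⟩, ⟨2, rfl⟩, ⟨3, rfl⟩]

/-- This separates an instruction from the word consumed with it: brackets can be written first, and
the word is then fed to all memories. -/
theorem MemInstr.apply_eq_unchanged (v : List α) (s : MemInstr) (c : MemConfig α) :
    s.apply v c = MemInstr.unchanged.apply v (s.apply [] c) := by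
  rcases c with ⟨u, _ | _⟩ <;> cases s <;> simp [MemInstr.apply]

/-- The word that is consumed by a transition. -/
def MemLabel.value (m : Fin k → MemConfig α) : MemLabel α k → List α
  | letter a => [a]
  | eps => []
  | memory b => (m b).content

/-- The word of the first parts of recalled memories. -/
def MemLabel.prefixValue (m' : Fin k × Bool → MemConfig α) : MemLabel α k → List α
  | letter _ => []
  | eps => []
  | memory b => (m' (b, false)).content

/-- A memory `c` is represented by two memories: `p` alone if it is not split (`t = false`), and
otherwise `p` and `s`, between whose contents the word `z` is left out. -/
structure SplitsAs (z : List α) (o t : Bool) (c p s : MemConfig α) : Prop where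
  isOpen : c.isOpen = o
  fst_isOpen : p.isOpen = (o && !t)
  snd_isOpen : s.isOpen = (o && t)
  content : c.content = if t then p.content ++ z ++ s.content else p.content

/-- Every memory of `m` is represented by two memories of `m'`; those in `T` are split. -/
def SplitMem (z : List α) (O T : Fin k → Bool) (m : Fin k → MemConfig α)
    (m' : Fin k × Bool → MemConfig α) : Prop :=
  ∀ i, SplitsAs z (O i) (T i) (m i) (m' (i, false)) (m' (i, true))

/-- The status of a memory after an instruction. -/
def MemInstr.status (o : Bool) : MemInstr → Bool
  | unchanged => o
  | opening => true
  | closing => false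
  | reset => false

/-- Whether a memory is split after an instruction. -/
def MemInstr.split (t : Bool) : MemInstr → Bool
  | unchanged => t
  | opening => false
  | closing => t
  | reset => false

/-- The brackets by which an instruction is carried out. -/
def MemInstr.word (α : Type*) (o t : Bool) (i : Fin k) :
    MemInstr → List (RefLetter α (Fin k × Bool))
  | unchanged => []
  | opening => (if o then [.closing (i, t)] else []) ++ [.opening (i, false)]
  | closing => if o then [.closing (i, t)] else []
  | reset => (if o then [.closing (i, t)] else []) ++ [.opening (i, false), .closing (i, false)]

/-- An automaton may reopen an open memory or close a closed one, which `Eval` forbids, so the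
brackets depend on the status: an open memory is first closed in the part `(i, t)` in use. A fresh
memory starts unsplit, and old content of its second part is ignored. -/
theorem SplitsAs.eval_word {z : List α} {o t : Bool} {c : MemConfig α} {i : Fin k}
    {m' : Fin k × Bool → MemConfig α} (h : SplitsAs z o t c (m' (i, false)) (m' (i, true)))
    (s : MemInstr) :
    ∃ m'', Eval m' (s.word α o t i) [] m'' ∧
      SplitsAs z (s.status o) (s.split t) (s.apply [] c) (m'' (i, false)) (m'' (i, true)) ∧
      (s.split t = true → (m'' (i, false)).content = (m' (i, false)).content) ∧
      ∀ j ≠ i, ∀ b, m'' (j, b) = m' (j, b) := by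
  classical
  obtain ⟨h1, h2, h3, h4⟩ := h
  rcases c with ⟨u, co⟩
  obtain rfl : co = o := h1
  have hclose : ∃ m'', Eval m' (MemInstr.closing.word α co t i) [] m'' ∧
      (∀ b, m'' (i, b) = ⟨(m' (i, b)).content, false⟩) ∧
      ∀ j ≠ i, ∀ b, m'' (j, b) = m' (j, b) := by
    rcases co with _ | _
    · refine ⟨m', .nil _, fun b => ?_, fun _ _ _ => rfl⟩
      have : (m' (i, b)).isOpen = false := by cases b <;> simp_all
      rw [← this]
    · refine ⟨_, .closing ?_ (.nil _), fun b => ?_, fun j hj b => by simp [hj]⟩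
      · cases t <;> simp_all
      · by_cases hb : b = t
        · subst hb; simp
        · have : (m' (i, b)).isOpen = false := by cases b <;> cases t <;> simp_all
          simp [hb, ← this]
  obtain ⟨m₁, e₁, h₁, h₁'⟩ := hclose
  cases s with
  | unchanged =>
    exact ⟨m', .nil _, ⟨by simp [MemInstr.status], h2, h3, by simpa [MemInstr.split] using h4⟩,
      fun _ => rfl, fun _ _ _ => rfl⟩
  | closing =>
    exact ⟨m₁, e₁, ⟨rfl, by simp [h₁, MemInstr.status], by simp [h₁, MemInstr.status],
      by simpa [h₁, MemInstr.split, MemInstr.apply] using h4⟩, by simp [h₁], h₁'⟩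
  | opening =>
    refine ⟨_, e₁.append (.opening (by simp [h₁]) (.nil _)), ⟨rfl, ?_, ?_, ?_⟩, ?_, ?_⟩ <;>
      simp +contextual [h₁, MemInstr.status, MemInstr.split, MemInstr.apply, h₁']
  | reset =>
    refine ⟨_, e₁.append (.opening (by simp [h₁]) (.closing (by simp) (.nil _))),
      ⟨rfl, ?_, ?_, ?_⟩, ?_, ?_⟩ <;>
      simp +contextual [h₁, MemInstr.status, MemInstr.split, MemInstr.apply, h₁']

/-- The brackets by which simultaneous instructions are carried out. -/
def instrWord (α : Type*) (s : Fin k → MemInstr) (O T : Fin k → Bool) :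
    List (RefLetter α (Fin k × Bool)) :=
  (List.finRange k).flatMap fun i => (s i).word α (O i) (T i) i

/-- The brackets for a memory affect only its own two parts and read nothing, so the instructions
can be carried out one memory after another. -/
theorem SplitMem.eval_instrWord {z : List α} {O T : Fin k → Bool} {m : Fin k → MemConfig α}
    {m' : Fin k × Bool → MemConfig α} (h : SplitMem z O T m m') (s : Fin k → MemInstr) :
    ∃ m'', Eval m' (instrWord α s O T) [] m'' ∧
      SplitMem z (fun i => (s i).status (O i)) (fun i => (s i).split (T i))
        (fun i => (s i).apply [] (m i)) m'' ∧
      ∀ i, (s i).split (T i) = true → (m'' (i, false)).content = (m' (i, false)).content := by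
  have key : ∀ l : List (Fin k), l.Nodup → ∃ m'',
      Eval m' (l.flatMap fun i => (s i).word α (O i) (T i) i) [] m'' ∧
      (∀ i ∈ l, SplitsAs z ((s i).status (O i)) ((s i).split (T i)) ((s i).apply [] (m i))
        (m'' (i, false)) (m'' (i, true)) ∧
        ((s i).split (T i) = true → (m'' (i, false)).content = (m' (i, false)).content)) ∧
      ∀ i ∉ l, ∀ b, m'' (i, b) = m' (i, b) := by
    intro l hl
    induction l using List.reverseRecOn with
    | nil => exact ⟨m', .nil _, by simp, fun _ _ _ => rfl⟩
    | append_singleton l i ih =>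
      rw [List.nodup_append] at hl
      have hil : i ∉ l := fun hi => hl.2.2 i hi i (by simp) rfl
      obtain ⟨m₁, e₁, h₁, h₁'⟩ := ih hl.1
      obtain ⟨m₂, e₂, h₂, h₂', h₂''⟩ := SplitsAs.eval_word (m' := m₁) (i := i)
        (by rw [h₁' i hil, h₁' i hil]; exact h i) (s i)
      refine ⟨m₂, ?_, ?_, ?_⟩
      · simpa using e₁.append e₂
      · intro j hj
        rcases eq_or_ne j i with rfl | hji
        · exact ⟨h₂, fun hs => by rw [h₂' hs, h₁' j hil]⟩
        · rw [h₂'' j hji, h₂'' j hji]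
          exact h₁ j (by simpa [hji] using hj)
      · intro j hj b
        simp only [List.mem_append, List.mem_singleton, not_or] at hj
        rw [h₂'' j hj.2, h₁' j hj.1]
  obtain ⟨m'', e, h₁, -⟩ := key (List.finRange k) (List.nodup_finRange k)
  exact ⟨m'', e, fun i => (h₁ i (by simp)).1, fun i => (h₁ i (by simp)).2⟩

theorem SplitMem.feed {z : List α} {O T : Fin k → Bool} {m : Fin k → MemConfig α}
    {m' : Fin k × Bool → MemConfig α} (h : SplitMem z O T m m') (v : List α) :
    SplitMem z O T (fun i => MemInstr.unchanged.apply v (m i))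
      (fun y => MemInstr.unchanged.apply v (m' y)) := by
  intro i
  obtain ⟨h1, h2, h3, h4⟩ := h i
  refine ⟨by simpa using h1, by simpa using h2, by simpa using h3, ?_⟩
  simp only [MemInstr.apply_unchanged_content, h1, h2, h3, h4]
  cases O i <;> cases T i <;> simp

/-- The parts `b` of the memories in `U`. -/
def splitVars (U : Fin k → Bool) (b : Bool) : List (Fin k × Bool) :=
  ((List.finRange k).filter U).map (·, b)

theorem mem_splitVars {U : Fin k → Bool} {b : Bool} {y : Fin k × Bool} :
    y ∈ splitVars U b ↔ U y.1 = true ∧ y.2 = b := by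
  rcases y with ⟨i, c⟩
  simp only [splitVars, List.mem_map, List.mem_filter, List.mem_finRange, true_and]
  constructor
  · rintro ⟨j, hj, h⟩
    cases h
    exact ⟨hj, rfl⟩
  · rintro ⟨hi, rfl⟩
    exact ⟨i, hi, rfl⟩

theorem nodup_splitVars (U : Fin k → Bool) (b : Bool) : (splitVars U b).Nodup :=
  ((List.nodup_finRange k).filter U).map fun _ _ h => congrArg Prod.fst h

/-- The word that splits the memories in `U` while the word `z` is read. -/
def splitWord (z : List α) (U : Fin k → Bool) : List (RefLetter α (Fin k × Bool)) :=
  (splitVars U false).map .closing ++ z.map .terminal ++ (splitVars U true).map .opening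

/-- The memories after those in `U` have been split. -/
def splitMem (z : List α) (U : Fin k → Bool) (m' : Fin k × Bool → MemConfig α) :
    Fin k × Bool → MemConfig α := fun y =>
  if U y.1 then (if y.2 then ⟨[], true⟩ else ⟨(m' (y.1, false)).content, false⟩)
  else MemInstr.unchanged.apply z (m' y)

theorem eval_map_terminal {X : Type*} (z : List α) (m : X → MemConfig α) :
    Eval m (z.map .terminal) z (fun y => MemInstr.unchanged.apply z (m y)) := by
  induction z generalizing m with
  | nil => simpa using Eval.nil m
  | cons a z ih => simpa [MemInstr.apply_unchanged_append] using Eval.terminal (ih _)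

open Classical in
theorem eval_map_closing {X : Type*} (l : List X) (hl : l.Nodup) (m : X → MemConfig α)
    (hm : ∀ x ∈ l, (m x).isOpen = true) :
    Eval m (l.map .closing) [] (fun y => if y ∈ l then ⟨(m y).content, false⟩ else m y) := by
  induction l generalizing m with
  | nil => simpa using Eval.nil m
  | cons a l ih =>
    obtain ⟨ha, hl⟩ := List.nodup_cons.1 hl
    refine .closing (hm a (by simp)) ?_
    convert ih hl _ ?_ using 1
    · funext y
      by_cases hy : y = a <;> simp [hy, ha]
    · intro x hx
      have hxa : x ≠ a := fun h => ha (h ▸ hx)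
      simpa [hxa] using hm x (by simp [hx])

open Classical in
theorem eval_map_opening {X : Type*} (l : List X) (hl : l.Nodup) (m : X → MemConfig α)
    (hm : ∀ x ∈ l, (m x).isOpen = false) :
    Eval m (l.map .opening) [] (fun y => if y ∈ l then ⟨[], true⟩ else m y) := by
  induction l generalizing m with
  | nil => simpa using Eval.nil m
  | cons a l ih =>
    obtain ⟨ha, hl⟩ := List.nodup_cons.1 hl
    refine .opening (hm a (by simp)) ?_
    convert ih hl _ ?_ using 1
    · funext y
      by_cases hy : y = a <;> simp [hy, ha]
    · intro x hx
      have hxa : x ≠ a := fun h => ha (h ▸ hx)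
      simpa [hxa] using hm x (by simp [hx])

theorem eval_splitWord (z : List α) (U : Fin k → Bool) (m' : Fin k × Bool → MemConfig α)
    (h : ∀ i, U i = true → (m' (i, false)).isOpen = true ∧ (m' (i, true)).isOpen = false) :
    Eval m' (splitWord z U) z (splitMem z U m') := by
  classical
  have e₁ := (eval_map_closing _ (nodup_splitVars U false) m' fun y hy => by
    rcases y with ⟨i, b⟩
    obtain ⟨hi, rfl⟩ := mem_splitVars.1 hy
    exact (h i hi).1).append (eval_map_terminal z _)
  have e₂ := e₁.append (eval_map_opening _ (nodup_splitVars U true) _ fun y hy => by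
    rcases y with ⟨i, b⟩
    obtain ⟨hi, rfl⟩ := mem_splitVars.1 hy
    simpa [mem_splitVars] using (h i hi).2)
  rw [List.nil_append, List.append_nil] at e₂
  convert e₂ using 1
  · rfl
  funext y
  rcases y with ⟨i, b⟩
  cases hU : U i <;> cases b <;> simp [splitMem, hU, MemInstr.apply, mem_splitVars]

/-- The first part of a memory in `U` holds its whole content so far. Closing it, leaving out `z`
and opening an empty second part represents that content followed by `z`. -/
theorem SplitMem.splitMem {z : List α} {O T U : Fin k → Bool} {m : Fin k → MemConfig α}
    {m' : Fin k × Bool → MemConfig α} (h : SplitMem z O T m m')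
    (hU : ∀ i, U i = true → O i = true ∧ T i = false) :
    SplitMem z O (fun i => T i || U i) (fun i => MemInstr.unchanged.apply z (m i))
      (splitMem z U m') := by
  intro i
  cases hUi : U i with
  | false => simpa [_root_.splitMem, hUi] using h.feed z i
  | true =>
    obtain ⟨h1, h2, h3, h4⟩ := h i
    obtain ⟨hO, hT⟩ := hU i hUi
    refine ⟨by simpa using h1, ?_, ?_, ?_⟩ <;>
      simp_all [_root_.splitMem, MemInstr.apply_unchanged_content]

end

/-! ### Consuming input while memories are split -/

section

variable {α : Type*} {k : ℕ}

/-- The words by which a transition with a given label consumes its input while the memories in the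
last argument are split. -/
inductive Emission (l : Option α) (O T : Fin k → Bool) :
    MemLabel α k → List (RefLetter α (Fin k × Bool)) → (Fin k → Bool) → Prop
  | letter (a) : Emission l O T (.letter a) [.terminal a] T
  | letter_split (a U) (hl : l = some a) (hU : ∀ i, U i = true → O i = true ∧ T i = false) :
      Emission l O T (.letter a) (splitWord l.toList U) fun i => T i || U i
  | eps : Emission l O T .eps [] T
  | memory (b) (hb : T b = false) : Emission l O T (.memory b) [.ref (b, false)] T
  | memory_split (b U) (hb : T b = true) (hU : ∀ i, U i = true → O i = true ∧ T i = false) :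
      Emission l O T (.memory b) (.ref (b, false) :: (splitWord l.toList U ++ [.ref (b, true)]))
        fun i => T i || U i

/-- No further memory has to be split; for the recall of a split memory this is the case of empty
`U`. -/
theorem exists_emission (l : Option α) (O T : Fin k → Bool) (lab : MemLabel α k) :
    ∃ e, Emission l O T lab e T := by
  cases lab with
  | letter a => exact ⟨_, .letter a⟩
  | eps => exact ⟨_, .eps⟩
  | memory b =>
    cases hb : T b with
    | false => exact ⟨_, .memory b hb⟩
    | true =>
      have := Emission.memory_split (l := l) (O := O) b (fun _ => false) hb (by simp)
      simp only [Bool.or_false] at this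
      exact ⟨_, this⟩

theorem finite_emission [Finite α] (l : Option α) (O T T' : Fin k → Bool) :
    {e | ∃ lab, Emission l O T lab e T'}.Finite := by
  refine ((((Set.finite_range fun a : α => [RefLetter.terminal a]).union
    (Set.finite_range fun U => splitWord l.toList U)).union
    (Set.finite_range fun b : Fin k => [RefLetter.ref (b, false)])).union
    ((Set.finite_range fun p : Fin k × (Fin k → Bool) =>
      RefLetter.ref (p.1, false) :: (splitWord l.toList p.2 ++ [.ref (p.1, true)])).union
      (Set.finite_singleton []))).subset ?_
  rintro e ⟨lab, h⟩
  cases h with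
  | letter a => exact Or.inl (Or.inl (Or.inl ⟨a, rfl⟩))
  | letter_split a U => exact Or.inl (Or.inl (Or.inr ⟨U, rfl⟩))
  | eps => exact Or.inr (Or.inr rfl)
  | memory b => exact Or.inl (Or.inr ⟨b, rfl⟩)
  | memory_split b U => exact Or.inr (Or.inl ⟨(b, U), rfl⟩)

/-- Recalling a split memory writes out the omitted word between its parts. At that moment open
memories can be split at the same occurrence, and their first parts then end with the first part of
the recalled memory, which `prefixValue` records. -/
theorem Emission.eval {l : Option α} {O T T' : Fin k → Bool} {lab : MemLabel α k} {e}
    (he : Emission l O T lab e T') {m : Fin k → MemConfig α} {m' : Fin k × Bool → MemConfig α}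
    (h : SplitMem l.toList O T m m') (hO : ∀ b, lab = .memory b → O b = false) :
    ∃ m'', Eval m' e (lab.value m) m'' ∧
      SplitMem l.toList O T' (fun i => MemInstr.unchanged.apply (lab.value m) (m i)) m'' ∧
      (∀ i, T i = true → (m'' (i, false)).content = (m' (i, false)).content) ∧
      ∀ i, T i = false → T' i = true →
        (m'' (i, false)).content = (m' (i, false)).content ++ lab.prefixValue m' := by
  have hfix : ∀ v i, T i = true →
      (MemInstr.unchanged.apply v (m' (i, false))).content = (m' (i, false)).content := by
    intro v i hi
    rw [MemInstr.apply_unchanged_of_closed _ (by simp [(h i).fst_isOpen, hi])]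
  have hsplit : ∀ {m : Fin k → MemConfig α} {m' : Fin k × Bool → MemConfig α} {U : Fin k → Bool},
      SplitMem l.toList O T m m' → (∀ i, U i = true → O i = true ∧ T i = false) →
      Eval m' (splitWord l.toList U) l.toList (splitMem l.toList U m') := by
    intro m m' U h hU
    exact eval_splitWord _ _ _ fun i hi => by simp [(h i).fst_isOpen, (h i).snd_isOpen, hU i hi]
  cases he with
  | letter a => exact ⟨_, .terminal (.nil _), h.feed [a], hfix _, by simp +contextual⟩
  | letter_split a U hl hU =>
    have ha : l.toList = [a] := by rw [hl]; rfl
    have e := hsplit h hU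
    have hs := h.splitMem hU
    rw [ha] at e hs ⊢
    refine ⟨_, e, hs, ?_, ?_⟩
    · intro i hi
      have : U i = false := by
        by_contra hUi
        simp [(hU i (by simpa using hUi)).2] at hi
      simpa [splitMem, this] using hfix _ i hi
    · intro i hi hi'
      have : U i = true := by simpa [hi] using hi'
      simp [splitMem, this, MemLabel.prefixValue]
  | eps => exact ⟨_, .nil _, by simpa [MemLabel.value] using h, fun _ _ => rfl, by simp +contextual⟩
  | memory b hb =>
    have hob := hO b rfl
    obtain ⟨h1, h2, h3, h4⟩ := h b
    have hv : (m b).content = (m' (b, false)).content := by simpa [hb] using h4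
    refine ⟨_, ?_, h.feed _, hfix _, by simp +contextual⟩
    have := Eval.ref (by simpa [hob] using h2) (.nil _)
    rw [List.append_nil, ← hv] at this
    exact this
  | memory_split b U hb hU =>
    have hob := hO b rfl
    have hUb : U b = false := by
      by_contra hUb
      simp [(hU b (by simpa using hUb)).1] at hob
    obtain ⟨h1, h2, h3, h4⟩ := h b
    simp only [hob, hb, Bool.false_and] at h2 h3
    set p := (m' (b, false)).content
    set s := (m' (b, true)).content with hs
    have hv : (m b).content = p ++ (l.toList ++ s) := by simpa [hb] using h4
    have hf := h.feed p
    have h₁ := hf.splitMem hU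
    -- Memory `b` is closed and not among those being split, so its second part is untouched until
    -- it is recalled.
    have hbs : splitMem l.toList U (fun y => MemInstr.unchanged.apply p (m' y)) (b, true) =
        m' (b, true) := by
      simp [splitMem, hUb, MemInstr.apply_unchanged_of_closed _ h3]
    have e : Eval m' (.ref (b, false) :: (splitWord l.toList U ++ [.ref (b, true)])) _ _ :=
      .ref h2 ((hsplit hf hU).append (.ref (by rw [hbs, h3]) (.nil _)))
    rw [hbs, List.append_nil, ← hs, ← hv] at e
    refine ⟨_, e, ?_, ?_, ?_⟩
    · have := h₁.feed s
      simp only [MemInstr.apply_unchanged_append, List.append_assoc, ← hv] at this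
      exact this
    · intro i hi
      have hUi : U i = false := by
        by_contra hUi
        simp [(hU i (by simpa using hUi)).2] at hi
      simpa [splitMem, hUi, MemInstr.apply_unchanged_append] using hfix _ i hi
    · intro i hi hi'
      have hUi : U i = true := by simpa [hi] using hi'
      have : (m' (i, false)).isOpen = true := by simp [(h i).fst_isOpen, hU i hUi]
      simp [splitMem, hUi, MemLabel.prefixValue, MemInstr.apply_unchanged_content, this, p]

end

/-! ### The regular set of ref-words that simulates an automaton -/

namespace TMFA

variable {α : Type u} {k : ℕ} (M : TMFA α k)

/-- The vertices of the graph of ref-words that simulates `M`: a state, the set of open memories,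
and the set of split memories. -/
abbrev SplitState : Type := M.State × (Fin k → Bool) × (Fin k → Bool)

/-- The ref-words that simulate a transition of `M` other than a recall failure. -/
def splitEdges (l : Option α) (c c' : M.SplitState) : Language (RefLetter α (Fin k × Bool)) :=
  {u | ∃ lab s e, (c'.1, s) ∈ M.trans c.1 lab ∧ (∀ b, lab = .memory b → s b = .closing) ∧
    u = instrWord α s c.2.1 c.2.2 ++ e ∧ c'.2.1 = (fun i => (s i).status (c.2.1 i)) ∧
    Emission l c'.2.1 (fun i => (s i).split (c.2.2 i)) lab e c'.2.2}

/-- The recall of memory `b` is possible in state `q`. -/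
def CanRecall (q : M.State) (b : Fin k) : Prop :=
  ∃ p s, (p, s) ∈ M.trans q (.memory b) ∧ s b = .closing

/-- The words of terminals that do not begin with `l`. -/
def _root_.terminalWords (X : Type*) (l : Option α) : Language (RefLetter α X) :=
  {r | ∃ x : List α, x.head? ≠ l ∧ r = x.map .terminal}

/-- The ref-words by which an accepting run of `M` ends in the given vertex without failure. -/
def splitFinal (c : M.SplitState) : Language (RefLetter α (Fin k × Bool)) :=
  {u | c.1 ∈ M.final ∧ u ∈ ({instrWord α (fun _ => .closing) c.2.1 c.2.2} :
    Language (RefLetter α (Fin k × Bool)))}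

/-- The ref-words by which an accepting run of `M` ends in the given vertex by a failure to recall
memory `b`. -/
def splitFail (l : Option α) (c : M.SplitState) (b : Fin k) :
    Language (RefLetter α (Fin k × Bool)) :=
  {u | (M.trap ∈ M.final ∧ l ≠ none ∧ c.2.2 b = true ∧ M.CanRecall c.1 b) ∧
    u ∈ ({[.ref (b, false)]} * (terminalWords (Fin k × Bool) l *
      {instrWord α (fun _ => .closing) c.2.1 c.2.2}) : Language (RefLetter α (Fin k × Bool)))}

/-- The vertex in which the simulation starts. -/
def splitStart : M.SplitState := (M.start, fun _ => false, fun _ => false)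

/-- The ref-words along the paths from the initial vertex to `c`. -/
def splitPaths (l : Option α) (c : M.SplitState) : Language (RefLetter α (Fin k × Bool)) :=
  {u | Language.Path (M.splitEdges l) M.splitStart u c}

/-- The ref-words that simulate the accepting runs of `M`. -/
def splitWords : Language (RefLetter α (Fin k × Bool)) :=
  ⨆ l : Option α, ⨆ c : M.SplitState, M.splitPaths l c * (M.splitFinal c + ⨆ b, M.splitFail l c b)

/-- Once a first letter has passed the test no condition on the terminals remains, so there are at
most three left quotients. -/
theorem _root_.isRegular_terminalWords (X : Type*) (l : Option α) :
    (terminalWords X l).IsRegular := by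
  let A : Language (RefLetter α X) := {r | ∃ x : List α, r = x.map RefLetter.terminal}
  refine Language.IsRegular.of_finite_range_leftQuotient
    ((Set.toFinite {terminalWords X l, A, 0}).subset ?_)
  rintro _ ⟨r, rfl⟩
  rcases eq_or_ne r [] with rfl | hr
  · exact Or.inl rfl
  by_cases h : ∃ x : List α, x.head? ≠ l ∧ r = x.map .terminal
  · obtain ⟨x, hx, rfl⟩ := h
    refine Or.inr (Or.inl (Language.ext fun r => ?_))
    have hx' : x ≠ [] := by simpa using hr
    constructor
    · rintro ⟨y, -, hy⟩
      obtain ⟨y₁, y₂, rfl, -, rfl⟩ := List.append_eq_map_iff.1 hy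
      exact ⟨y₂, rfl⟩
    · rintro ⟨y, rfl⟩
      refine ⟨x ++ y, ?_, by simp⟩
      rwa [List.head?_append_of_ne_nil x hx']
  · refine Or.inr (Or.inr (Language.ext fun r' => ⟨?_, fun h => absurd h (Language.notMem_zero _)⟩))
    rintro ⟨y, hy', hy⟩
    obtain ⟨y₁, y₂, rfl, rfl, rfl⟩ := List.append_eq_map_iff.1 hy
    refine absurd ⟨y₁, ?_, rfl⟩ h
    rwa [List.head?_append_of_ne_nil y₁ (by simpa using hr)] at hy'

theorem isRegular_splitWords [Finite α] : M.splitWords.IsRegular := by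
  have := M.finite_state
  have hC := Language.rationallyClosed_isRegular (L := RefLetter α (Fin k × Bool))
  refine hC.iSup fun l => hC.iSup fun c => hC.mul (hC.path ?_ _ _) (hC.add ?_ (hC.iSup fun b => ?_))
  · intro c c'
    refine hC.of_finite ?_ fun u _ => Language.isRegular_word u
    refine ((Set.finite_range fun s : Fin k → MemInstr => s).biUnion (t := fun s =>
      (instrWord α s c.2.1 c.2.2 ++ ·) '' {e | ∃ lab, Emission l c'.2.1
        (fun i => (s i).split (c.2.2 i)) lab e c'.2.2})
      fun s _ => (finite_emission _ _ _ _).image _).subset ?_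
    rintro u ⟨lab, s, e, -, -, rfl, -, he⟩
    exact Set.mem_biUnion ⟨s, rfl⟩ ⟨e, ⟨lab, he⟩, rfl⟩
  · exact hC.and (Language.isRegular_word _)
  · exact hC.and (hC.mul (Language.isRegular_word _)
      (hC.mul (isRegular_terminalWords _ _) (Language.isRegular_word _)))

variable {M}

/-- The automaton accepts from the given configuration. -/
def AcceptsFrom (M : TMFA α k) (c : M.Config) : Prop :=
  ∃ c' : M.Config, Relation.ReflTransGen M.Step c c' ∧ c'.input = [] ∧ c'.state ∈ M.final

theorem acceptsFrom_trap (h : M.trap ∈ M.final) (x : List α) (m : Fin k → MemConfig α) :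
    M.AcceptsFrom ⟨M.trap, x, m⟩ := by
  induction x generalizing m with
  | nil => exact ⟨_, .refl, rfl, h⟩
  | cons a x ih =>
    obtain ⟨c, h₁, h₂⟩ := ih fun i => MemInstr.unchanged.apply [a] (m i)
    refine ⟨c, .head (.letter (s := fun _ => .unchanged) ?_) h₁, h₂⟩
    rw [M.trans_trap_letter]
    rfl

theorem step_of_mem_trans {q p : M.State} {s : Fin k → MemInstr} {lab : MemLabel α k}
    (h : (p, s) ∈ M.trans q lab) (hs : ∀ b, lab = .memory b → s b = .closing)
    (m : Fin k → MemConfig α) (x : List α) :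
    M.Step ⟨q, lab.value m ++ x, m⟩ ⟨p, x, fun i => (s i).apply (lab.value m) (m i)⟩ := by
  cases lab with
  | letter a => exact .letter h
  | eps => exact .eps h
  | memory b => exact .memory_recall h (hs b rfl) rfl

theorem _root_.MemLabel.value_apply {s : Fin k → MemInstr} {lab : MemLabel α k}
    (hs : ∀ b, lab = .memory b → s b = .closing) (m : Fin k → MemConfig α) :
    lab.value (fun i => (s i).apply [] (m i)) = lab.value m := by
  cases lab with
  | letter a => rfl
  | eps => rfl
  | memory b => simp [MemLabel.value, hs b rfl, MemInstr.apply]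

theorem eval_splitEdge {l : Option α} {c : M.SplitState} {s : Fin k → MemInstr}
    {lab : MemLabel α k} {e} {T'} {m : Fin k → MemConfig α} {m' : Fin k × Bool → MemConfig α}
    (hs : ∀ b, lab = .memory b → s b = .closing)
    (he : Emission l (fun i => (s i).status (c.2.1 i)) (fun i => (s i).split (c.2.2 i)) lab e T')
    (h : SplitMem l.toList c.2.1 c.2.2 m m') :
    ∃ m'', Eval m' (instrWord α s c.2.1 c.2.2 ++ e) (lab.value m) m'' ∧
      SplitMem l.toList (fun i => (s i).status (c.2.1 i)) T'
        (fun i => (s i).apply (lab.value m) (m i)) m'' ∧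
      (∀ i, (s i).split (c.2.2 i) = true →
        (m'' (i, false)).content = (m' (i, false)).content) ∧
      ((∀ b, lab = .memory b → c.2.2 b = true) →
        ∀ i, (s i).split (c.2.2 i) = false → T' i = true → (m'' (i, false)).content =
          ((s i).apply [] (m i)).content ++ lab.prefixValue m') := by
  obtain ⟨m₁, e₁, h₁, h₁'⟩ := h.eval_instrWord s
  obtain ⟨m₂, e₂, h₂, h₂', h₂''⟩ := he.eval h₁ fun b hb => by simp [hs b hb, MemInstr.status]
  rw [MemLabel.value_apply hs] at e₂ h₂
  refine ⟨m₂, e₁.append e₂, ?_, fun i hi => by rw [h₂' i hi, h₁' i hi], ?_⟩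
  · simpa only [← MemInstr.apply_eq_unchanged] using h₂
  · intro hlab i hi hi'
    have hpre : lab.prefixValue m₁ = lab.prefixValue m' := by
      cases lab with
      | letter a => rfl
      | eps => rfl
      | memory b => exact h₁' b (by simp [hs b rfl, MemInstr.split, hlab b rfl])
    have := (h₁ i).content
    simp only [hi, Bool.false_eq_true, if_false] at this
    rw [h₂'' i hi hi', hpre, this]

/-- Soundness: whichever splits are guessed, the path follows a genuine run without recall failure.
These moves do not look ahead, so the rest `x` of the input is arbitrary. -/
theorem eval_of_path {l : Option α} {c c' : M.SplitState} {u}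
    (hu : Language.Path (M.splitEdges l) c u c') {m : Fin k → MemConfig α}
    {m' : Fin k × Bool → MemConfig α} (h : SplitMem l.toList c.2.1 c.2.2 m m') :
    ∃ w m₁ m₁', Eval m' u w m₁' ∧ SplitMem l.toList c'.2.1 c'.2.2 m₁ m₁' ∧
      ∀ x, Relation.ReflTransGen M.Step ⟨c.1, w ++ x, m⟩ ⟨c'.1, x, m₁⟩ := by
  induction hu generalizing m m' with
  | nil => exact ⟨_, _, _, .nil _, h, fun x => .refl⟩
  | cons hu _ ih =>
    obtain ⟨lab, s, e, hps, hs, rfl, hO, he⟩ := hu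
    rw [hO] at he
    obtain ⟨m₁, e₁, h₁, -⟩ := eval_splitEdge hs he h
    rw [← hO] at h₁
    obtain ⟨w, m₂, m₂', e₂, h₂, h₂'⟩ := ih h₁
    refine ⟨_, m₂, m₂', e₁.append e₂, h₂, fun x => ?_⟩
    rw [List.append_assoc]
    exact .head (step_of_mem_trans hps hs m _) (h₂' x)

theorem _root_.SplitMem.eval_closing {z : List α} {O T : Fin k → Bool} {m : Fin k → MemConfig α}
    {m' : Fin k × Bool → MemConfig α} (h : SplitMem z O T m m') :
    ∃ m'', Eval m' (instrWord α (fun _ => .closing) O T) [] m'' ∧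
      ∀ x, (m'' x).isOpen = false := by
  obtain ⟨m'', e, h', -⟩ := h.eval_instrWord fun _ => .closing
  refine ⟨m'', e, ?_⟩
  rintro ⟨i, _ | _⟩
  · simpa [MemInstr.status] using (h' i).fst_isOpen
  · simpa [MemInstr.status] using (h' i).snd_isOpen

theorem _root_.SplitMem.eval_fail {z : List α} {O T : Fin k → Bool} {m : Fin k → MemConfig α}
    {m' : Fin k × Bool → MemConfig α} (h : SplitMem z O T m m') {b : Fin k} (hb : T b = true)
    (x : List α) :
    ∃ m'', Eval m' ([.ref (b, false)] ++ (x.map .terminal ++ instrWord α (fun _ => .closing) O T))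
      ((m' (b, false)).content ++ x) m'' ∧ ∀ x, (m'' x).isOpen = false := by
  obtain ⟨m'', e, h'⟩ := ((h.feed (m' (b, false)).content).feed x).eval_closing
  refine ⟨m'', ?_, h'⟩
  have := (eval_map_terminal x _).append e
  rw [List.append_nil] at this
  exact .ref (by simp [(h b).fst_isOpen, hb]) this

/-- At a final failure the recalled memory contains p ++ a :: s, while the input continues with p
and a word not beginning with a. The recall fails after p, and the accepting trap reads the rest; `l
≠ none` provides the letter a. -/
theorem eval_of_mem_splitWords {r} (hr : r ∈ M.splitWords) :
    ∃ w m, Eval emptyMem r w m ∧ (∀ x, (m x).isOpen = false) ∧ w ∈ M.language := by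
  obtain ⟨l, hr⟩ := Language.mem_iSup.1 hr
  obtain ⟨c, hr⟩ := Language.mem_iSup.1 hr
  obtain ⟨u, hu, t, ht, rfl⟩ := Language.mem_mul.1 hr
  have h₀ : SplitMem l.toList M.splitStart.2.1 M.splitStart.2.2 (emptyMem : Fin k → MemConfig α)
      emptyMem := fun i => ⟨rfl, rfl, rfl, rfl⟩
  obtain ⟨w, m, m', e, h, hw⟩ := eval_of_path hu h₀
  rcases ht with ⟨hf, rfl⟩ | ht
  · obtain ⟨m'', e', h'⟩ := h.eval_closing
    exact ⟨_, _, e.append e', h', _, hw [], rfl, hf⟩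
  · obtain ⟨b, ⟨htrap, hl, hb, p, s, hps, hs⟩, ht⟩ := Language.mem_iSup.1 ht
    obtain ⟨_, rfl, _, ht', rfl⟩ := Language.mem_mul.1 ht
    obtain ⟨_, ⟨x, hx, rfl⟩, _, rfl, rfl⟩ := Language.mem_mul.1 ht'
    obtain ⟨m'', e', h'⟩ := h.eval_fail hb x
    obtain ⟨a, rfl⟩ := Option.ne_none_iff_exists'.1 hl
    obtain ⟨c', h₁, h₂⟩ := acceptsFrom_trap htrap x m
    refine ⟨_, _, e.append e', h', c', (hw _).trans (.head ?_ h₁), h₂⟩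
    have hcont := (h b).content
    rw [hb, if_pos rfl, List.append_assoc] at hcont
    exact .recall_failure hps hs rfl hcont (by simp) (by simpa using hx.symm)

/-! ### Every accepting run is simulated -/

/-- The configurations that are reached without a recall failure. -/
inductive Reads (M : TMFA α k) : List α → M.State → (Fin k → MemConfig α) → Prop
  | start : Reads M [] M.start emptyMem
  | step {w q m p s lab} (h : Reads M w q m) (hp : (p, s) ∈ M.trans q lab)
      (hs : ∀ b, lab = .memory b → s b = .closing) :
      Reads M (w ++ lab.value m) p fun i => (s i).apply (lab.value m) (m i)

/-- The word `w` is read up to a recall failure. -/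
def Fails (M : TMFA α k) (w : List α) : Prop :=
  ∃ v q m b v₁ v₂ x, M.Reads v q m ∧ M.CanRecall q b ∧ (m b).content = v₁ ++ v₂ ∧ v₂ ≠ [] ∧
    v₂.head? ≠ x.head? ∧ w = v ++ (v₁ ++ x)

/-- After a failure the run stays in the trap, so the rest of the input is irrelevant. A trap
reached by ordinary transitions belongs to the first case. -/
theorem reads_or_fails {w : List α} {c : M.Config}
    (h : Relation.ReflTransGen M.Step (M.initial w) c) :
    (∃ v, M.Reads v c.state c.mem ∧ w = v ++ c.input) ∨ (c.state = M.trap ∧ M.Fails w) := by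
  induction h with
  | refl => exact Or.inl ⟨[], .start, rfl⟩
  | tail _ hs ih =>
    rcases ih with ⟨v, hv, rfl⟩ | ⟨htrap, hf⟩
    · cases hs with
      | letter h => exact Or.inl ⟨_, hv.step h (by simp), by simp [MemLabel.value]⟩
      | eps h => exact Or.inl ⟨_, hv.step h (by simp), by simp [MemLabel.value]⟩
      | memory_recall h hb hx =>
        refine Or.inl ⟨_, hv.step h fun b' hb' => ?_, by simp [MemLabel.value, hx]⟩
        cases hb'
        exact hb
      | recall_failure h hb hx hu hv' hw =>
        exact Or.inr ⟨rfl, _, _, _, _, _, _, _, hv, ⟨_, _, h, hb⟩, hu, hv', hw, by simp [hx]⟩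
    · refine Or.inr ⟨?_, hf⟩
      cases hs with
      | letter h =>
        dsimp only at htrap
        rw [htrap, M.trans_trap_letter] at h
        exact congrArg Prod.fst h
      | eps h =>
        dsimp only at htrap
        rw [htrap, M.trans_trap_eps] at h
        exact congrArg Prod.fst h
      | memory_recall h =>
        dsimp only at htrap
        rw [htrap, M.trans_trap_recall] at h
        exact h.elim
      | recall_failure => rfl

/-- The configuration given by `c` and `m`, reached by reading `w`, is represented by `m'`. -/
def Simulates (l : Option α) (w : List α) (c : M.SplitState) (m : Fin k → MemConfig α)
    (m' : Fin k × Bool → MemConfig α) : Prop :=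
  SplitMem l.toList c.2.1 c.2.2 m m' ∧ ∃ u ∈ M.splitPaths l c, Eval emptyMem u w m'

theorem Simulates.step {l : Option α} {w : List α} {q p : M.State} {O T T' : Fin k → Bool}
    {m : Fin k → MemConfig α} {m' : Fin k × Bool → MemConfig α} {s : Fin k → MemInstr}
    {lab : MemLabel α k} {e} (h : Simulates l w (q, O, T) m m') (hp : (p, s) ∈ M.trans q lab)
    (hs : ∀ b, lab = .memory b → s b = .closing)
    (he : Emission l (fun i => (s i).status (O i)) (fun i => (s i).split (T i)) lab e T') :
    ∃ m'', Simulates (M := M) l (w ++ lab.value m) (p, fun i => (s i).status (O i), T')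
        (fun i => (s i).apply (lab.value m) (m i)) m'' ∧
      (∀ i, (s i).split (T i) = true → (m'' (i, false)).content = (m' (i, false)).content) ∧
      ((∀ b, lab = .memory b → T b = true) →
        ∀ i, (s i).split (T i) = false → T' i = true → (m'' (i, false)).content =
          ((s i).apply [] (m i)).content ++ lab.prefixValue m') := by
  obtain ⟨h, u, hu, hu'⟩ := h
  obtain ⟨m'', e', h₁, h₂⟩ := eval_splitEdge (c := (q, O, T)) hs he h
  refine ⟨m'', ⟨h₁, _, Language.Path.append hu (.single ?_), hu'.append e'⟩, h₂⟩
  exact ⟨lab, s, e, hp, hs, rfl, rfl, he⟩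

theorem Reads.simulates {w : List α} {q : M.State} {m : Fin k → MemConfig α}
    (h : M.Reads w q m) (l : Option α) :
    ∃ O m', Simulates (M := M) l w (q, O, fun _ => false) m m' := by
  induction h with
  | start => exact ⟨_, emptyMem, fun i => ⟨rfl, rfl, rfl, rfl⟩, [], .nil _, .nil _⟩
  | @step w q m p s lab _ hp hs ih =>
    obtain ⟨O, m', h⟩ := ih
    obtain ⟨e, he⟩ := exists_emission l (fun i => (s i).status (O i)) (fun _ => false) lab
    have hT : (fun i => (s i).split false) = fun _ => false := by
      funext i
      cases s i <;> rfl
    obtain ⟨m'', h', -⟩ := h.step hp hs (by rw [hT]; exact he)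
    exact ⟨_, m'', h'⟩

theorem _root_.MemInstr.split_eq_true {t : Bool} {s : MemInstr} (h : s.split t = true) :
    t = true ∧ (s = .unchanged ∨ s = .closing) := by
  cases s <;> simp_all [MemInstr.split]

theorem _root_.MemInstr.isOpen_apply (v : List α) (s : MemInstr) (c : MemConfig α) :
    (s.apply v c).isOpen = s.status c.isOpen := by
  rcases c with ⟨u, _ | _⟩ <;> cases s <;> rfl

theorem _root_.MemInstr.apply_nil_content {s : MemInstr} {c : MemConfig α}
    (h : (s.apply [] c).content ≠ []) :
    (s = .unchanged ∨ s = .closing) ∧ (s.apply [] c).content = c.content := by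
  rcases c with ⟨u, _ | _⟩ <;> cases s <;> simp_all [MemInstr.apply]

/-- The occurrence of `a` is traced back. If it was in `b` before the last step, the earlier split
persists. If it was just read as a letter, `b` is split now; if it was copied from a recalled
memory, that memory is split there by induction, and `b` is split during the recall. The last clause
ensures that `b` is then not already split elsewhere. -/
theorem Reads.simulates_split {w : List α} {q : M.State} {m : Fin k → MemConfig α}
    (h : M.Reads w q m) {b : Fin k} {v v₂ : List α} {a : α} (hb : (m b).content = v ++ a :: v₂) :
    ∃ O T m', Simulates (M := M) (some a) w (q, O, T) m m' ∧ T b = true ∧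
      (m' (b, false)).content = v ∧ ∀ i, T i = true → O i = true → i = b := by
  classical
  induction h generalizing b v v₂ with
  | start => simp [emptyMem] at hb
  | @step w q m p s lab hr hp hs ih =>
    set c := (s b).apply [] (m b) with hc
    -- Either the marked position lies in what the instruction itself leaves in the memory, or in
    -- the word appended in this step, with `x` the portion of that word before it.
    have hb' : c.content = v ++ a :: (c.content.drop (v.length + 1)) ∨
        (c.isOpen = true ∧ ∃ x, v = c.content ++ x ∧ lab.value m = x ++ a :: v₂) := by
      change ((s b).apply (lab.value m) (m b)).content = _ at hb
      rw [MemInstr.apply_eq_unchanged, MemInstr.apply_unchanged_content, ← hc] at hb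
      split_ifs at hb with ho
      · rcases List.append_eq_append_iff.1 hb with ⟨x, h₁, h₂⟩ | ⟨x, h₁, h₂⟩
        · exact Or.inr ⟨ho, x, h₁, h₂⟩
        · rcases x with _ | ⟨a', x⟩
          · exact Or.inr ⟨ho, [], by simpa using h₁.symm, by simpa using h₂.symm⟩
          · obtain ⟨rfl, -⟩ := List.cons_eq_cons.1 h₂
            left
            rw [h₁]
            simp
      · left
        rw [hb]
        simp
    rcases hb' with hb' | ⟨ho, x, rfl, hx⟩
    · have hcase := MemInstr.apply_nil_content (s := s b) (c := m b) (by rw [← hc, hb']; simp)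
      rw [← hc] at hcase
      rw [hcase.2] at hb'
      obtain ⟨O, T, m', h, hTb, hcont, huniq⟩ := ih hb'
      obtain ⟨e, he⟩ := exists_emission (some a) (fun i => (s i).status (O i))
        (fun i => (s i).split (T i)) lab
      obtain ⟨m'', h', h₁, -⟩ := h.step hp hs he
      have hTb' : (s b).split (T b) = true := by
        rcases hcase.1 with h | h <;> simpa [h, MemInstr.split] using hTb
      refine ⟨_, _, m'', h', hTb', by rw [h₁ b hTb', hcont], fun i hi hi' => ?_⟩
      obtain ⟨hTi, h | h⟩ := MemInstr.split_eq_true hi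
      · exact huniq i hTi (by simpa [h, MemInstr.status] using hi')
      · simp [h, MemInstr.status] at hi'
    · cases lab with
      | eps => simp [MemLabel.value] at hx
      | letter a' =>
        obtain ⟨rfl, rfl, rfl⟩ : x = [] ∧ a' = a ∧ v₂ = [] := by
          rcases x with _ | ⟨_, _⟩ <;> simp_all [MemLabel.value]
        obtain ⟨O, m', h⟩ := hr.simulates (some a')
        have hO : (s b).status (O b) = true := by
          have hOb : (m b).isOpen = O b := (h.1 b).isOpen
          rwa [← hOb, ← MemInstr.isOpen_apply []]
        have hT : ∀ i, (s i).split false = false := fun i => by cases s i <;> rfl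
        obtain ⟨m'', h', -, h₁⟩ := h.step hp hs
          (.letter_split a' (fun i => decide (i = b)) rfl (by simp [hO, hT]))
        refine ⟨_, _, m'', h', by simp, ?_, by simp [hT]⟩
        rw [h₁ (by simp) b (hT b) (by simp)]
        rfl
      | memory d =>
        have hsd := hs d rfl
        obtain ⟨O, T, m', h, hTd, hcont, huniq⟩ := ih (b := d) hx
        have hO : (s b).status (O b) = true := by
          have hOb : (m b).isOpen = O b := (h.1 b).isOpen
          rwa [← hOb, ← MemInstr.isOpen_apply []]
        -- Before this step only `d` could be both split and open, and its recall closes it; hence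
        -- no split memory is open now.
        have hopen : ∀ i, (s i).split (T i) = true → (s i).status (O i) ≠ true := by
          intro i hi hi'
          obtain ⟨hTi, h | h⟩ := MemInstr.split_eq_true hi
          · obtain rfl := huniq i hTi (by simpa [h, MemInstr.status] using hi')
            rw [hsd] at h
            cases h
          · simp [h, MemInstr.status] at hi'
        have hT : (s b).split (T b) = false := by
          by_contra hT
          exact hopen b (by simpa using hT) hO
        obtain ⟨m'', h', -, h₁⟩ := h.step hp hs
          (.memory_split d (fun i => decide (i = b)) (by simp [hsd, MemInstr.split, hTd])
            (by simp [hO, hT]))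
        refine ⟨_, _, m'', h', by simp, ?_, ?_⟩
        · rw [h₁ (by simpa using hTd) b hT (by simp), ← hcont]
          rfl
        · intro i hi hi'
          by_contra hib
          exact hopen i (by simpa [hib] using hi) hi'

/-- Without failure nothing is split and `l = none` serves. With a failure, `l` is the first letter
of the part of the recalled memory that was not matched. -/
theorem exists_splitWord_of_mem_language {w : List α} (hw : w ∈ M.language) :
    ∃ r ∈ M.splitWords, ∃ m, Eval emptyMem r w m := by
  obtain ⟨c, hc, hi, hf⟩ := hw
  rcases reads_or_fails hc with ⟨v, hv, rfl⟩ | ⟨htrap, v, q, m, b, v₁, v₂, x, hv, hq, hb, h₂, hx, rfl⟩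
  · obtain ⟨O, m', h, u, hu, hu'⟩ := hv.simulates none
    obtain ⟨m'', e, -⟩ := h.eval_closing
    refine ⟨u ++ _, Language.mem_iSup.2 ⟨none, Language.mem_iSup.2 ⟨_,
      Language.append_mem_mul hu (Or.inl ⟨hf, rfl⟩)⟩⟩, m'', ?_⟩
    rw [hi]
    exact hu'.append e
  · obtain ⟨a, v₂, rfl⟩ := List.exists_cons_of_ne_nil h₂
    obtain ⟨O, T, m', ⟨h, u, hu, hu'⟩, hT, rfl, -⟩ := hv.simulates_split hb
    obtain ⟨m'', e, -⟩ := h.eval_fail hT x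
    refine ⟨u ++ _, Language.mem_iSup.2 ⟨some a, Language.mem_iSup.2 ⟨_,
      Language.append_mem_mul hu (Or.inr (Language.mem_iSup.2 ⟨b, ⟨htrap ▸ hf, by simp, hT, hq⟩,
        Language.append_mem_mul rfl (Language.append_mem_mul ⟨x, ?_, rfl⟩ rfl)⟩))⟩⟩, m'',
      hu'.append e⟩
    simpa using hx.symm

theorem isMemoryRegular_language [Finite α] (M : TMFA α k) :
    IsMemoryRegular (Fin k × Bool) M.language := by
  refine ⟨M.splitWords, M.isRegular_splitWords, fun r hr => ?_, fun w => ⟨?_, ?_⟩⟩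
  · obtain ⟨w, m, e, h, -⟩ := eval_of_mem_splitWords hr
    exact ⟨w, m, e, h⟩
  · exact exists_splitWord_of_mem_language
  · rintro ⟨r, hr, m, e⟩
    obtain ⟨w', m', e', -, hw⟩ := eval_of_mem_splitWords hr
    rwa [(e.unique e').1]

end TMFA

theorem mainTheorem11 {α : Type*} {Ξ : Type*} [Finite α] [Infinite Ξ] :
    tmfaLanguages α = tmfaRejLanguages α ∧ tmfaRejLanguages α = regexLanguages α Ξ := by
  have h₁ : tmfaRejLanguages α ⊆ tmfaLanguages α := by
    rintro l ⟨k, M, -, rfl⟩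
    exact ⟨k, M, rfl⟩
  have h₂ : tmfaLanguages α ⊆ regexLanguages α Ξ := by
    rintro l ⟨k, M, rfl⟩
    exact M.isMemoryRegular_language.mem_regexLanguages
  have h₃ := regexLanguages_subset_tmfaRejLanguages α Ξ
  exact ⟨(h₂.trans h₃).antisymm h₁, (h₁.trans h₂).antisymm h₃⟩
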